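/- Let $p$ be a prime with $p \equiv 53$ or $77 \pmod{120}$ and let $E_p$ be the elliptic curve $y^2=(x+6p)(x-9p)(x-18p)$ over $\mathbb{Q}$. Let $S=\{p,2,3,5,\infty\}$ and let $\mathbb{Q}(S,2)$ be the group of classes $b\in\mathbb{Q}^*/(\mathbb{Q}^*)^2$ with $\mathrm{ord}_l(b)$ even for all primes $l\notin S$. The $2$-Selmer group $\mathrm{Sel}_2(E_p/\mathbb{Q})$ consists of the pairs $(b_1,b_2)\in\mathbb{Q}(S,2)\times\mathbb{Q}(S,2)$ for which the homogeneous space $$b_1z_1^2-b_2z_2^2=15p,\qquad b_1z_1^2-b_1b_2z_3^2=24p$$ has a solution $(z_1,z_2,z_3)$ in $\mathbb{R}^3$ and in $\mathbb{Q}_l^3$ for every prime $l$; the $2$-Selmer rank of $E_p$ is the integer $s(E_p)$ with $\#\mathrm{Sel}_2(E_p/\mathbb{Q})=2^{2+s(E_p)}$. Then the $2$-Selmer rank of $E_p$ is $0$. That is, $\#\mathrm{Sel}_2(E_p/\mathbb{Q})=4=\#E_p(\mathbb{Q})[2]$. Moreover, the Mordell–Weil group $E_p(\mathbb{Q})$ has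 rank $0$. -/

import Mathlib

namespace SelmerEp

/-- The Weierstrass curve `y² = (x + 6p)(x - 9p)(x - 18p) = x³ - 21p x² + 972p³` over `ℚ`. -/
def curve (p : ℕ) : WeierstrassCurve ℚ where
  a₁ := 0
  a₂ := -21 * (p : ℚ)
  a₃ := 0
  a₄ := 0
  a₆ := 972 * (p : ℚ) ^ 3

/-- The affine equation of `curve p` is the factored one. -/
theorem curve_equation_iff (p : ℕ) (x y : ℚ) :
    (curve p).toAffine.Equation x y ↔
      y ^ 2 = (x + 6 * (p : ℚ)) * (x - 9 * (p : ℚ)) * (x - 18 * (p : ℚ)) := by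
  rw [WeierstrassCurve.Affine.equation_iff]
  simp only [curve]
  constructor <;> intro h <;> linear_combination h

theorem curve_disc (p : ℕ) :
    (curve p).Δ = 16 * 2 ^ 6 * 3 ^ 8 * 5 ^ 2 * (p : ℚ) ^ 6 := by
  simp only [curve, WeierstrassCurve.Δ, WeierstrassCurve.b₂, WeierstrassCurve.b₄,
    WeierstrassCurve.b₆, WeierstrassCurve.b₈]
  ring

/-- `curve p` is an elliptic curve for `p ≠ 0`. -/
theorem curve_isElliptic (p : ℕ) (hp : p ≠ 0) : (curve p).IsElliptic := by
  have h : (p : ℚ) ≠ 0 := by exact_mod_cast hp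
  refine ⟨isUnit_iff_ne_zero.mpr ?_⟩
  rw [curve_disc]
  positivity

/-- The group `ℚ* / (ℚ*)²`. -/
abbrev SquareClass : Type := ℚˣ ⧸ (powMonoidHom 2 : ℚˣ →* ℚˣ).range

/-- The nonzero rationals `b` with `ord_l(b)` even for every prime `l ∉ S`. -/
def evenOutside (S : Set ℕ) : Subgroup ℚˣ where
  carrier := {b | ∀ l : ℕ, l.Prime → l ∉ S → Even (padicValRat l (b : ℚ))}
  one_mem' := by
    intro l _ _
    simp
  mul_mem' := by
    intro a b ha hb l hl hS
    have : Fact l.Prime := ⟨hl⟩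
    rw [Units.val_mul, padicValRat.mul a.ne_zero b.ne_zero]
    exact (ha l hl hS).add (hb l hl hS)
  inv_mem' := by
    intro a ha l hl hS
    have : Fact l.Prime := ⟨hl⟩
    rw [Units.val_inv_eq_inv_val, padicValRat.inv]
    exact (ha l hl hS).neg

/-- `ℚ(S, 2)`: the classes in `ℚ* / (ℚ*)²` with even valuation at every prime outside `S`.
(The valuation of a class is well defined modulo `2`.) -/
def QS2 (S : Set ℕ) : Subgroup SquareClass :=
  (evenOutside S).map (QuotientGroup.mk' (powMonoidHom 2 : ℚˣ →* ℚˣ).range)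

/-- The finite places in `S` for the curve `E_p`: the primes of bad reduction and `2`. -/
def badPrimes (p : ℕ) : Set ℕ := {p, 2, 3, 5}

/-- The homogeneous space of `E_p` attached to `(b₁, b₂)`, given by
`b₁ z₁² - b₂ z₂² = 15 p` and `b₁ z₁² - b₁ b₂ z₃² = 24 p`, has a point over the field `K`. -/
def HasPoint (K : Type) [Field K] (p : ℕ) (b₁ b₂ : ℚˣ) : Prop :=
  ∃ z₁ z₂ z₃ : K,
    ((b₁ : ℚ) : K) * z₁ ^ 2 - ((b₂ : ℚ) : K) * z₂ ^ 2 = 15 * (p : K) ∧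
    ((b₁ : ℚ) : K) * z₁ ^ 2 - ((b₁ : ℚ) : K) * ((b₂ : ℚ) : K) * z₃ ^ 2 = 24 * (p : K)

/-- The homogeneous space attached to `(b₁, b₂)` has points over every completion of `ℚ`. -/
def EverywhereLocallySoluble (p : ℕ) (b₁ b₂ : ℚˣ) : Prop :=
  HasPoint ℝ p b₁ b₂ ∧ ∀ (l : ℕ) [Fact l.Prime], HasPoint ℚ_[l] p b₁ b₂

/-- The property of having a point depends only on the square classes of `b₁` and `b₂`. -/
theorem HasPoint.mul_sq {K : Type} [Field K] [CharZero K] {p : ℕ} {b₁ b₂ : ℚˣ}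
    (h : HasPoint K p b₁ b₂) (c₁ c₂ : ℚˣ) : HasPoint K p (b₁ * c₁ ^ 2) (b₂ * c₂ ^ 2) := by
  obtain ⟨z₁, z₂, z₃, h₁, h₂⟩ := h
  have hc₁ : ((c₁ : ℚ) : K) ≠ 0 := by exact_mod_cast c₁.ne_zero
  have hc₂ : ((c₂ : ℚ) : K) ≠ 0 := by exact_mod_cast c₂.ne_zero
  refine ⟨z₁ / (c₁ : ℚ), z₂ / (c₂ : ℚ), z₃ / ((c₁ : ℚ) * (c₂ : ℚ)), ?_, ?_⟩
  · rw [← h₁]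
    push_cast
    field_simp
  · rw [← h₂]
    push_cast
    field_simp

/-- The `2`-Selmer group of `E_p` over `ℚ`: the pairs in `ℚ(S, 2) × ℚ(S, 2)` whose homogeneous
space has points over every completion of `ℚ`. -/
def selmerTwo (p : ℕ) : Set (SquareClass × SquareClass) :=
  {c | c.1 ∈ QS2 (badPrimes p) ∧ c.2 ∈ QS2 (badPrimes p) ∧
    ∃ b₁ b₂ : ℚˣ, (b₁ : SquareClass) = c.1 ∧ (b₂ : SquareClass) = c.2 ∧
      EverywhereLocallySoluble p b₁ b₂}

/-- The `2`-Selmer rank of `E_p` is `s`, where `#Sel₂(E_p/ℚ) = 2 ^ (2 + s)`. -/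
def HasSelmerRank (p s : ℕ) : Prop :=
  Nat.card (selmerTwo p) = 2 ^ (2 + s)

end SelmerEp

/-! Put X = x + 6p, so that the cubic is X(X - 15p)(X - 24p). A local point of the homogeneous space
of (b₁, b₂) is an X for which b₁X, b₂(X - 15p) and b₁b₂(X - 24p) are squares (X = b₁z₁²).

At l = p, 3, 5 the four 2-torsion points already give every local class: a soluble pair agrees in
ℚ_l with (1, 1), (10, -15p), (15p, -15) or (6p, p) up to squares. The proof localizes X. If X is
large, X and its translates have the same class; if X reduces to a root, Hensel's lemma pins the
remaining factors; otherwise the product of the three factors has odd valuation, although it must be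
a square. The reduction at 5 needs a separate count of residues (`isTorsionClass_at_self`,
`isTorsionClass_at_three`, `isTorsionClass_at_five`).

Represent b₁ and b₂ by ±2^a 3^b 5^c p^d. The congruences on p make 2, 3, 5 nonresidues and -1 a
residue mod p, and p a nonresidue mod 3 and mod 5. Each of p, 3, 5 then gives two linear equations
over 𝔽₂ in the ten exponents, and the real place gives b₁ > 0. Seven equations leave eight pairs:
the four torsion classes and their translates by (1, 6). The translates have no 2-adic point, by
parity of valuations. The torsion classes are soluble everywhere, so the Selmer group has order 4.

For the rank, the Kummer class of a rational point lies in the Selmer group, so P or P + T, with T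
of order 2, is divisible by 2. Hence 2P ∈ 4E(ℚ), and every element of 2E(ℚ) is twice an element of
2E(ℚ). Since h(2Q) ≥ 4h(Q) - C and there are finitely many points of bounded height, repeated
halving is periodic. Every point is therefore torsion. -/

namespace SelmerEp

/-! ### Squares and valuations in ℚ_l. -/

section Padic

variable {l : ℕ} [Fact l.Prime]

theorem toZMod_ne_zero_iff (u : ℤ_[l]) : PadicInt.toZMod u ≠ 0 ↔ ‖u‖ = 1 := by
  rw [← PadicInt.isUnit_iff, ← not_iff_not, not_not, ← RingHom.mem_ker, PadicInt.ker_toZMod,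
    IsLocalRing.mem_maximalIdeal, mem_nonunits_iff]

theorem exists_natCast_toZMod (r : ZMod l) : ∃ n : ℕ, PadicInt.toZMod (n : ℤ_[l]) = r :=
  ⟨r.val, by simp⟩

/-- Hensel's lemma for square roots of units at odd primes. -/
theorem isSquare_padic_of_toZMod (hl : l ≠ 2) {a : ℤ_[l]} (ha : PadicInt.toZMod a ≠ 0)
    (hs : IsSquare (PadicInt.toZMod a)) : IsSquare (a : ℚ_[l]) := by
  obtain ⟨r, hr⟩ := hs
  obtain ⟨n, hn⟩ := exists_natCast_toZMod r
  have hr0 : r ≠ 0 := by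
    rintro rfl
    exact ha (by rw [hr, mul_zero])
  have hn1 : ‖(n : ℤ_[l])‖ = 1 := (toZMod_ne_zero_iff _).1 (hn ▸ hr0)
  have h2 : ‖(2 : ℤ_[l])‖ = 1 := by
    have h : ((2 : ℕ) : ℤ_[l]) = 2 := by norm_num
    rw [← h, PadicInt.norm_natCast_eq_one_iff]
    exact (Nat.coprime_primes Fact.out Nat.prime_two).2 hl
  have hlt : ‖(n : ℤ_[l]) ^ 2 - a‖ < 1 := by
    refine lt_of_le_of_ne (PadicInt.norm_le_one _) fun h => ?_
    rw [← toZMod_ne_zero_iff] at h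
    apply h
    rw [map_sub, map_pow, hn, hr, sq, sub_self]
  obtain ⟨z, hz, -⟩ := hensels_lemma (p := l) (R := ℤ_[l])
    (F := Polynomial.X ^ 2 - Polynomial.C a) (a := (n : ℤ_[l])) (by
      simpa [hn1, h2, one_add_one_eq_two] using hlt)
  refine ⟨(z : ℚ_[l]), ?_⟩
  have hz' : z ^ 2 - a = 0 := by simpa using hz
  rw [← PadicInt.coe_mul, ← sq, sub_eq_zero.1 hz']

theorem isSquare_toZMod_of_padic {a : ℤ_[l]} (hs : IsSquare (a : ℚ_[l])) :
    IsSquare (PadicInt.toZMod a) := by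
  obtain ⟨r, hr⟩ := hs
  have h1 : ‖r‖ ≤ 1 := by
    have h := PadicInt.norm_le_one a
    rw [PadicInt.norm_def, hr, norm_mul, ← sq] at h
    exact (sq_le_one_iff₀ (norm_nonneg r)).1 h
  obtain ⟨s, rfl⟩ : ∃ s : ℤ_[l], (s : ℚ_[l]) = r := ⟨⟨r, h1⟩, rfl⟩
  have h2 : a = s * s := PadicInt.ext (by rw [hr, PadicInt.coe_mul])
  rw [h2, map_mul]
  exact ⟨_, rfl⟩

theorem even_valuation_of_isSquare {a : ℚ_[l]} (hs : IsSquare a) : Even a.valuation := by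
  obtain ⟨r, rfl⟩ := hs
  by_cases hr : r = 0
  · simp [hr]
  · rw [Padic.valuation_mul hr hr]
    exact ⟨_, rfl⟩

theorem coe_ne_zero_of_toZMod {u : ℤ_[l]} (hu : PadicInt.toZMod u ≠ 0) : (u : ℚ_[l]) ≠ 0 := by
  intro h
  exact hu (by rw [PadicInt.coe_eq_zero.1 h, map_zero])

theorem valuation_of_toZMod {u : ℤ_[l]} (hu : PadicInt.toZMod u ≠ 0) :
    (u : ℚ_[l]).valuation = 0 := by
  have h1 := (toZMod_ne_zero_iff u).1 hu
  rw [PadicInt.norm_def, Padic.norm_eq_zpow_neg_valuation (coe_ne_zero_of_toZMod hu)] at h1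
  have hl : (1 : ℝ) < l := by exact_mod_cast (Fact.out : l.Prime).one_lt
  have := (zpow_eq_one_iff_right₀ (by positivity) hl.ne').1 h1
  omega

theorem even_and_isSquare_of_isSquare_mul_pow {u : ℤ_[l]} (hu : PadicInt.toZMod u ≠ 0) {d : ℕ}
    (hs : IsSquare ((u : ℚ_[l]) * (l : ℚ_[l]) ^ d)) :
    IsSquare (PadicInt.toZMod u) ∧ Even d := by
  have hl : (l : ℚ_[l]) ≠ 0 := by exact_mod_cast (Fact.out : l.Prime).ne_zero
  have hu0 := coe_ne_zero_of_toZMod hu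
  have hd : Even d := by
    have h := even_valuation_of_isSquare hs
    rw [Padic.valuation_mul hu0 (pow_ne_zero _ hl), valuation_of_toZMod hu, Padic.valuation_pow,
      Padic.valuation_p] at h
    have h2 : Even (d : ℤ) := by simpa using h
    exact_mod_cast h2
  refine ⟨isSquare_toZMod_of_padic ?_, hd⟩
  have h3 : IsSquare ((l : ℚ_[l]) ^ d) := hd.isSquare_pow _
  have h4 := hs.div h3
  rwa [mul_div_cancel_right₀ _ (pow_ne_zero _ hl)] at h4

theorem not_isSquare_mul_prime {u : ℤ_[l]} (hu : PadicInt.toZMod u ≠ 0) :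
    ¬ IsSquare ((u : ℚ_[l]) * l) := by
  intro h
  have h2 := (even_and_isSquare_of_isSquare_mul_pow (d := 1) hu (by simpa using h)).2
  exact absurd h2 (by decide)

/-- Since x(x - d) = x²(1 - d/x) and 1 - d/x ≡ 1 mod l, Hensel's lemma applies. -/
theorem isSquare_mul_sub_of_norm_lt (hl : l ≠ 2) {x d : ℚ_[l]} (h : ‖d‖ < ‖x‖) :
    IsSquare (x * (x - d)) := by
  have hx : x ≠ 0 := by
    rintro rfl
    rw [norm_zero] at h
    exact absurd h (not_lt.2 (norm_nonneg d))
  have hn : ‖1 - d / x‖ = 1 := by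
    have h1 : ‖-(d / x)‖ < 1 := by
      rw [norm_neg, norm_div]
      exact (div_lt_one (norm_pos_iff.2 hx)).2 h
    rw [sub_eq_add_neg, Padic.add_eq_max_of_ne (by rw [norm_one]; exact h1.ne'), norm_one,
      max_eq_left h1.le]
  let e : ℤ_[l] := ⟨d / x, by rw [norm_div]; exact div_le_one_of_le₀ h.le (norm_nonneg x)⟩
  have he : PadicInt.toZMod e = 0 := by
    by_contra h0
    have h1 := (toZMod_ne_zero_iff e).1 h0
    rw [PadicInt.norm_def] at h1
    change ‖d / x‖ = 1 at h1
    rw [norm_div, div_eq_one_iff_eq (norm_ne_zero_iff.2 hx)] at h1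
    exact h.ne h1
  have h1 : IsSquare (((1 - e : ℤ_[l])) : ℚ_[l]) := by
    apply isSquare_padic_of_toZMod hl
    · simp [he]
    · simp [he]
  have h2 : x * (x - d) = x ^ 2 * ((1 - e : ℤ_[l]) : ℚ_[l]) := by
    have : ((1 - e : ℤ_[l]) : ℚ_[l]) = 1 - d / x := rfl
    rw [this]
    field_simp
  rw [h2]
  exact (IsSquare.sq x).mul h1

end Padic

theorem IsSquare.of_mul_right {K : Type*} [Field K] {a b : K} (hb : b ≠ 0)
    (h : IsSquare (a * b)) (h' : IsSquare b) : IsSquare a := by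
  have := h.div h'
  rwa [mul_div_cancel_right₀ _ hb] at this

theorem IsSquare.mul_trans {K : Type*} [Field K] {a b c : K} (hb : b ≠ 0)
    (h : IsSquare (a * b)) (h' : IsSquare (b * c)) : IsSquare (a * c) := by
  apply IsSquare.of_mul_right (pow_ne_zero 2 hb) _ (IsSquare.sq b)
  have : a * c * b ^ 2 = (a * b) * (b * c) := by ring
  rw [this]
  exact h.mul h'

/-- The pair `(b₁, b₂)` agrees modulo squares with the image of a `2`-torsion point. -/
def IsTorsionClass {K : Type} [Field K] (p : ℕ) (b₁ b₂ : K) : Prop :=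
  (IsSquare b₁ ∧ IsSquare b₂) ∨
  (IsSquare (b₁ * 10) ∧ IsSquare (b₂ * (-15 * p))) ∨
  (IsSquare (b₁ * (15 * p)) ∧ IsSquare (b₂ * (-15))) ∨
  (IsSquare (b₁ * (6 * p)) ∧ IsSquare (b₂ * p))

/-- The classes of b₁ and b₁b₂ determine that of b₂: b₁ ~ c and b₁b₂ ~ d force b₂ ~ cd ~ e. -/
theorem IsSquare.third {K : Type*} [Field K] {b₁ b₂ c d e : K} (hb : b₁ ≠ 0) (hc : c ≠ 0)
    (hd : d ≠ 0) (h₁ : IsSquare (b₁ * c)) (h₂ : IsSquare (b₁ * b₂ * d))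
    (h : IsSquare (c * d * e)) : IsSquare (b₂ * e) := by
  apply IsSquare.of_mul_right (pow_ne_zero 2 (mul_ne_zero (mul_ne_zero hb hc) hd)) _ (IsSquare.sq _)
  have : b₂ * e * (b₁ * c * d) ^ 2 = (b₁ * c) * (b₁ * b₂ * d) * (c * d * e) := by ring
  rw [this]
  exact (h₁.mul h₂).mul h

section Padic

variable {l : ℕ} [Fact l.Prime]

/-- Points with large `x`-coordinate have trivial image. -/
theorem isSquare_of_norm_lt (hl : l ≠ 2) {x d e b₁ b₂ : ℚ_[l]} (hb₁ : b₁ ≠ 0) (hb₂ : b₂ ≠ 0)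
    (h₁ : IsSquare (b₁ * x)) (h₂ : IsSquare (b₂ * (x - d))) (h₃ : IsSquare (b₁ * b₂ * (x - e)))
    (hd : ‖d‖ < ‖x‖) (he : ‖e‖ < ‖x‖) : IsSquare b₁ ∧ IsSquare b₂ := by
  have hx : x ≠ 0 := norm_pos_iff.1 ((norm_nonneg d).trans_lt hd)
  have key : ∀ {f : ℚ_[l]}, ‖f‖ < ‖x‖ → ∀ {b : ℚ_[l]}, IsSquare (b * (x - f)) →
      IsSquare (b * x) := by
    intro f hf b hb
    have h0 : x - f ≠ 0 := by
      intro h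
      exact hf.ne (by rw [sub_eq_zero.1 h])
    refine IsSquare.mul_trans h0 hb ?_
    rw [mul_comm]
    exact isSquare_mul_sub_of_norm_lt hl hf
  have h2' := key hd h₂
  have h3' := key he h₃
  have hb2 : IsSquare (b₂ * 1) := IsSquare.third hb₁ hx hx h₁ h3' ⟨x, by ring⟩
  rw [mul_one] at hb2
  have hxs : IsSquare x := by
    rw [mul_comm] at h2'
    exact IsSquare.of_mul_right hb₂ h2' hb2
  exact ⟨IsSquare.of_mul_right hx h₁ hxs, hb2⟩


/-- The image of a point cannot be that of an `x`-coordinate with product of odd valuation. -/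
theorem isSquare_prod {K : Type*} [Field K] {x y z b₁ b₂ : K} (hb₁ : b₁ ≠ 0) (hb₂ : b₂ ≠ 0)
    (h₁ : IsSquare (b₁ * x)) (h₂ : IsSquare (b₂ * y)) (h₃ : IsSquare (b₁ * b₂ * z)) :
    IsSquare (x * y * z) := by
  apply IsSquare.of_mul_right (pow_ne_zero 2 (mul_ne_zero hb₁ hb₂)) _ (IsSquare.sq _)
  have : x * y * z * (b₁ * b₂) ^ 2 = (b₁ * x) * (b₂ * y) * (b₁ * b₂ * z) := by ring
  rw [this]
  exact (h₁.mul h₂).mul h₃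

theorem exists_eq_prime_mul {x : ℚ_[l]} (hx : ‖x‖ ≤ ‖(l : ℚ_[l])‖) :
    ∃ u : ℤ_[l], x = l * u := by
  have hl : (l : ℚ_[l]) ≠ 0 := by exact_mod_cast (Fact.out : l.Prime).ne_zero
  refine ⟨⟨x / l, ?_⟩, ?_⟩
  · rw [norm_div]
    exact div_le_one_of_le₀ hx (norm_nonneg _)
  · change x = l * (x / l)
    field_simp

theorem exists_eq_prime_mul_of_toZMod {x : ℤ_[l]} (hx : PadicInt.toZMod x = 0) :
    ∃ u : ℤ_[l], x = l * u := by
  rw [← RingHom.mem_ker, PadicInt.ker_toZMod, PadicInt.maximalIdeal_eq_span_p,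
    Ideal.mem_span_singleton] at hx
  exact hx

theorem norm_natCast_mul_le (a : ℕ) : ‖((a : ℚ_[l]) * l)‖ ≤ ‖(l : ℚ_[l])‖ := by
  rw [norm_mul]
  have : ‖(a : ℚ_[l])‖ ≤ 1 := by exact_mod_cast Padic.norm_int_le_one (p := l) a
  exact mul_le_of_le_one_left (norm_nonneg _) this

end Padic

/-- The properties of `ℤ_l ⊆ ℚ_l` with its residue map that a computation of square classes at an
odd prime `l` uses. -/
structure OddLocal {R K k : Type*} [CommRing R] [Field K] [Field k] (i : R →+* K) (π : R →+* k)
    (ϖ : R) : Prop where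
  isSquare {a : R} : π a ≠ 0 → IsSquare (π a) → IsSquare (i a)
  not_isSquare {u : R} : π u ≠ 0 → ¬ IsSquare (i u * i ϖ)
  exists_eq_mul {x : R} : π x = 0 → ∃ u, x = ϖ * u
  ne_zero : i ϖ ≠ 0

namespace OddLocal

variable {R K k : Type*} [CommRing R] [Field K] [Field k] {i : R →+* K} {π : R →+* k} {ϖ : R}

theorem map_ne_zero (H : OddLocal i π ϖ) {u : R} (hu : π u ≠ 0) : i u ≠ 0 := by
  intro h
  refine H.not_isSquare hu ?_
  rw [h, zero_mul]
  exact ⟨0, by simp⟩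

/-- If `b x` is a square, `x = c u` and `y = d v` with `c d` a square and `u v` a square unit, then
`b y` is a square. -/
theorem isSquare_of_unit (H : OddLocal i π ϖ) {b x c d : K} {u v : R} (hc : c ≠ 0)
    (hb : IsSquare (b * x)) (hx : x = c * i u) (hcd : IsSquare (c * d)) (hu : π u ≠ 0)
    (hv : π v ≠ 0) (hs : IsSquare (π u * π v)) {y : K} (hy : y = d * i v) : IsSquare (b * y) := by
  have hx0 : x ≠ 0 := hx ▸ mul_ne_zero hc (H.map_ne_zero hu)
  refine IsSquare.mul_trans hx0 hb ?_
  have h : x * y = c * d * i (u * v) := by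
    rw [hx, hy, map_mul]
    ring
  rw [h]
  exact hcd.mul (H.isSquare (by rw [map_mul]; exact mul_ne_zero hu hv) (by rwa [map_mul]))

theorem not_isSquare_of_eq (H : OddLocal i π ϖ) {x c : K} {u : R} (hc : c ≠ 0) (hu : π u ≠ 0)
    (hx : x = c ^ 2 * (i u * i ϖ)) : ¬ IsSquare x := by
  intro h
  rw [hx, mul_comm] at h
  exact H.not_isSquare hu (IsSquare.of_mul_right (pow_ne_zero 2 hc) h (IsSquare.sq c))

end OddLocal

theorem oddLocal_padic {l : ℕ} [Fact l.Prime] (hl : l ≠ 2) :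
    OddLocal (PadicInt.Coe.ringHom (p := l)) (PadicInt.toZMod (p := l)) (l : ℤ_[l]) where
  isSquare := isSquare_padic_of_toZMod hl
  not_isSquare := not_isSquare_mul_prime
  exists_eq_mul := exists_eq_prime_mul_of_toZMod
  ne_zero := by
    rw [map_natCast]
    exact_mod_cast (Fact.out : l.Prime).ne_zero

attribute [local simp] map_ofNat

/-! ### Local images at p, 3 and 5 as residue computations. -/

section Generic

variable {R K k : Type} [CommRing R] [Field K] [CharZero K] [Field k] {i : R →+* K} {π : R →+* k}
  {b₁ b₂ : K} {p : ℕ} (hb₁ : b₁ ≠ 0) (hb₂ : b₂ ≠ 0)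
include hb₁ hb₂

/-- The factors are p·u, p(u - 15), p(u - 24), with three distinct roots mod p. At a root the two
other factors have known classes, and the product relation gives the third. -/
theorem isTorsionClass_at_self {u : R} (H : OddLocal i π (p : R)) (hk₂ : (2 : k) ≠ 0)
    (hk₃ : (3 : k) ≠ 0) (hk₅ : (5 : k) ≠ 0) (h₁ : IsSquare (b₁ * (p * i u)))
    (h₂ : IsSquare (b₂ * (p * i u - 15 * p))) (h₃ : IsSquare (b₁ * b₂ * (p * i u - 24 * p))) :
    IsTorsionClass p b₁ b₂ := by
  have z15 : (15 : k) ≠ 0 := by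
    have : (15 : k) = 3 * 5 := by norm_num
    rw [this]
    exact mul_ne_zero hk₃ hk₅
  have z9 : (9 : k) ≠ 0 := by
    have : (9 : k) = 3 * 3 := by norm_num
    rw [this]
    exact mul_ne_zero hk₃ hk₃
  have z24 : (24 : k) ≠ 0 := by
    have : (24 : k) = 2 * 2 * 2 * 3 := by norm_num
    rw [this]
    exact mul_ne_zero (mul_ne_zero (mul_ne_zero hk₂ hk₂) hk₂) hk₃
  have hp : (p : K) ≠ 0 := by simpa using H.ne_zero
  have hpp : IsSquare ((p : K) * p) := ⟨p, rfl⟩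
  right
  by_cases u0 : π u = 0
  · left
    have hy : IsSquare (b₂ * (-15 * p)) :=
      H.isSquare_of_unit (u := u - 15) (v := -15) (c := p) (d := p) hp h₂
        (by simp; ring) hpp (by simpa [u0] using z15) (by simpa using z15)
        ⟨15, by simp [u0]⟩ (by simp; ring)
    have hz : IsSquare (b₁ * b₂ * (-24 * p)) :=
      H.isSquare_of_unit (u := u - 24) (v := -24) (c := p) (d := p) hp h₃
        (by simp; ring) hpp (by simpa [u0] using z24) (by simpa using z24)
        ⟨24, by simp [u0]⟩ (by simp; ring)
    refine ⟨?_, hy⟩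
    rw [mul_comm b₁ b₂] at hz
    exact IsSquare.third hb₂ (by simp [hp]) (by simp [hp]) hy hz ⟨60 * p, by ring⟩
  by_cases u15 : π u = 15
  · right; left
    have hx : IsSquare (b₁ * (15 * p)) :=
      H.isSquare_of_unit (u := u) (v := 15) (c := p) (d := p) hp h₁
        rfl hpp u0 (by simpa using z15) ⟨15, by simp [u15]⟩ (by simp; ring)
    have hz : IsSquare (b₁ * b₂ * (-9 * p)) :=
      H.isSquare_of_unit (u := u - 24) (v := -9) (c := p) (d := p) hp h₃
        (by simp; ring) hpp (by rw [map_sub, u15, map_ofNat]; norm_num; exact z9)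
        (by simpa using z9) ⟨9, by simp [u15]; norm_num⟩ (by simp; ring)
    exact ⟨hx, IsSquare.third hb₁ (by simp [hp]) (by simp [hp]) hx hz ⟨45 * p, by ring⟩⟩
  by_cases u24 : π u = 24
  · right; right
    have z6 : (6 : k) ≠ 0 := by
      have : (6 : k) = 2 * 3 := by norm_num
      rw [this]
      exact mul_ne_zero hk₂ hk₃
    refine ⟨?_, ?_⟩
    · exact H.isSquare_of_unit (u := u) (v := 6) (c := p) (d := p) hp h₁
        rfl hpp u0 (by simpa using z6) ⟨12, by simp [u24]; norm_num⟩ (by simp; ring)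
    · exact H.isSquare_of_unit (u := u - 15) (v := 1) (c := p) (d := p) hp h₂
        (by simp; ring) hpp (by rw [map_sub, u24, map_ofNat]; norm_num; exact z9)
        (by simp) ⟨3, by simp [u24]; norm_num⟩ (by simp)
  -- Away from the roots all three cofactors are units, so the product has valuation 3.
  exfalso
  refine H.not_isSquare_of_eq (c := (p : K)) (u := u * (u - 15) * (u - 24)) hp ?_ ?_
    (isSquare_prod hb₁ hb₂ h₁ h₂ h₃)
  · simp only [map_mul, map_sub, map_ofNat]
    exact mul_ne_zero (mul_ne_zero u0 (sub_ne_zero.2 u15)) (sub_ne_zero.2 u24)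
  · simp
    ring

/-- After dividing by 3 the roots 0, 5p, 8p reduce to 0, 1, 1 mod 3. Near the double root a second
3-adic digit t is needed: there the roots are t ≡ 0 and t ≡ p ≡ 2. -/
theorem isTorsionClass_at_three {u : R} (H : OddLocal i π (3 : R)) (hk₃ : (3 : k) = 0)
    (hp : (p : k) = 2) (hk : ∀ r : k, r = 0 ∨ r = 1 ∨ r = 2) (h₁ : IsSquare (b₁ * (3 * i u)))
    (h₂ : IsSquare (b₂ * (3 * i u - 15 * p))) (h₃ : IsSquare (b₁ * b₂ * (3 * i u - 24 * p))) :
    IsTorsionClass p b₁ b₂ := by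
  have h30 : (3 : K) ≠ 0 := by norm_num
  have hp0 : (p : K) ≠ 0 := by
    intro h
    rw [Nat.cast_eq_zero] at h
    rw [h, Nat.cast_zero] at hp
    exact one_ne_zero (α := k) (by linear_combination hk₃ + hp)
  have h33 : IsSquare ((3 : K) * 3) := ⟨3, rfl⟩
  have z1 : (1 : k) ≠ 0 := one_ne_zero
  have z2 : (2 : k) ≠ 0 := fun h => z1 (by linear_combination hk₃ - h)
  right
  rcases hk (π u) with u0 | u1 | u2
  · left
    have hy : IsSquare (b₂ * (-15 * p)) :=
      H.isSquare_of_unit (u := u - 5 * p) (v := -5 * p) (c := 3) (d := 3) h30 h₂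
        (by simp; ring) h33
        (by simp only [map_sub, map_mul, map_ofNat, map_natCast, u0, hp]
            intro h; apply z1; linear_combination -3 * hk₃ - h)
        (by simp only [map_neg, map_mul, map_ofNat, map_natCast, hp]
            intro h; apply z1; linear_combination -3 * hk₃ - h)
        ⟨10, by simp [u0, hp]; norm_num⟩ (by simp; ring)
    have hz : IsSquare (b₁ * b₂ * (-24 * p)) :=
      H.isSquare_of_unit (u := u - 8 * p) (v := -8 * p) (c := 3) (d := 3) h30 h₃
        (by simp; ring) h33
        (by simp only [map_sub, map_mul, map_ofNat, map_natCast, u0, hp]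
            intro h; apply z1; linear_combination -5 * hk₃ - h)
        (by simp only [map_neg, map_mul, map_ofNat, map_natCast, hp]
            intro h; apply z1; linear_combination -5 * hk₃ - h)
        ⟨16, by simp [u0, hp]; norm_num⟩ (by simp; ring)
    refine ⟨?_, hy⟩
    rw [mul_comm b₁ b₂] at hz
    exact IsSquare.third hb₂ (by simp [hp0]) (by simp [hp0]) hy hz ⟨60 * p, by ring⟩
  · obtain ⟨t, ht⟩ := H.exists_eq_mul (x := u - 5 * p) (by
      simp only [map_sub, map_mul, map_ofNat, map_natCast, u1, hp]
      linear_combination -3 * hk₃)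
    obtain rfl : u = 5 * p + 3 * t := by linear_combination ht
    have h99 : IsSquare ((9 : K) * 9) := ⟨9, rfl⟩
    have h90 : (9 : K) ≠ 0 := by norm_num
    have zu : π (5 * p + 3 * t) ≠ 0 := by rw [u1]; exact z1
    rcases hk (π t) with t0 | t1 | t2
    · right; left
      have hx : IsSquare (b₁ * (15 * p)) :=
        H.isSquare_of_unit (u := 5 * p + 3 * t) (v := 5 * p) (c := 3) (d := 3) h30 h₁
          rfl h33 zu
          (by simp only [map_mul, map_ofNat, map_natCast, hp]
              intro h; apply z1; linear_combination -3 * hk₃ + h)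
          ⟨10, by rw [u1]; simp [hp]; linear_combination -30 * hk₃⟩ (by simp; ring)
      have hz : IsSquare (b₁ * b₂ * (-9 * p)) :=
        H.isSquare_of_unit (u := t - p) (v := -p) (c := 9) (d := 9) h90 h₃
          (by simp; ring) h99 (by simpa [t0, hp] using z2) (by simpa [hp] using z2)
          ⟨2, by simp [t0, hp]⟩ (by simp)
      exact ⟨hx, IsSquare.third hb₁ (by simp [hp0]) (by simp [hp0]) hx hz ⟨45 * p, by ring⟩⟩
    -- Here the valuations of the three factors are 1, 2, 2, with odd sum.
    · exfalso
      refine H.not_isSquare_of_eq (c := 9) (u := (5 * p + 3 * t) * t * (t - p)) h90 ?_ ?_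
        (isSquare_prod hb₁ hb₂ h₁ h₂ h₃)
      · simp only [map_mul, u1, map_sub, map_natCast, t1, hp]
        intro h; apply z1; linear_combination -h
      · simp
        ring
    · right; right
      refine ⟨?_, ?_⟩
      · exact H.isSquare_of_unit (u := 5 * p + 3 * t) (v := 2 * p) (c := 3) (d := 3) h30 h₁
          rfl h33 zu
          (by simp only [map_mul, map_ofNat, map_natCast, hp]
              intro h; apply z1; linear_combination -hk₃ + h)
          ⟨2, by rw [u1]; simp [hp]⟩ (by simp; ring)
      · exact H.isSquare_of_unit (u := t) (v := p) (c := 9) (d := 1) h90 h₂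
          (by simp; ring) ⟨3, by norm_num⟩ (by rw [t2]; exact z2) (by simpa [hp] using z2)
          ⟨2, by simp [t2, hp]⟩ (by simp)
  · exfalso
    refine H.not_isSquare_of_eq (c := 3) (u := u * (u - 5 * p) * (u - 8 * p)) h30 ?_ ?_
      (isSquare_prod hb₁ hb₂ h₁ h₂ h₃)
    · simp only [map_mul, u2, map_sub, map_natCast, map_ofNat, hp]
      intro h; apply z1; linear_combination 75 * hk₃ - h
    · simp
      ring

/-- The roots 0 and 15p collide mod 5, while 24p is a unit. A unit x has the same class as x - 15p,
which gives (1, 1) or (p, p), and 6 is a 5-adic square. If 5 divides x, the third factor is -24p up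
to squares, and the next digit of x selects the torsion class. -/
theorem isTorsionClass_at_five {x : R} (H : OddLocal i π (5 : R)) (hk₅ : (5 : k) = 0)
    (hp : (p : k) = 2 ∨ (p : k) = 3)
    (hk : ∀ r : k, IsSquare r ∨ IsSquare (r * 2)) (h₁ : IsSquare (b₁ * i x))
    (h₂ : IsSquare (b₂ * (i x - 15 * p))) (h₃ : IsSquare (b₁ * b₂ * (i x - 24 * p))) :
    IsTorsionClass p b₁ b₂ := by
  have h50 : (5 : K) ≠ 0 := by norm_num
  have z1 : (1 : k) ≠ 0 := one_ne_zero
  have z2 : (2 : k) ≠ 0 := fun h => z1 (by linear_combination hk₅ - 2 * h)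
  have z3 : (3 : k) ≠ 0 := fun h => z1 (by linear_combination 2 * h - hk₅)
  have zp : (p : k) ≠ 0 := by rcases hp with h | h <;> rw [h] <;> assumption
  have hp0 : (p : K) ≠ 0 := by
    intro h
    rw [Nat.cast_eq_zero] at h
    exact zp (by rw [h, Nat.cast_zero])
  have s2p : IsSquare (2 * p : k) := by
    rcases hp with h | h
    · exact ⟨2, by rw [h]⟩
    · exact ⟨1, by rw [h]; linear_combination hk₅⟩
  have sneg : IsSquare (-1 : k) := ⟨2, by linear_combination -hk₅⟩
  have h55 : IsSquare ((5 : K) * 5) := ⟨5, rfl⟩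
  have h11 : IsSquare ((1 : K) * 1) := ⟨1, rfl⟩
  have h6 : IsSquare (6 : K) := by
    have := H.isSquare (a := 6)
      (by rw [map_ofNat]; intro h; apply z1; linear_combination h - hk₅)
      ⟨1, by rw [map_ofNat]; linear_combination hk₅⟩
    rwa [map_ofNat] at this
  by_cases x0 : π x = 0
  · have hz : IsSquare (b₁ * b₂ * (-24 * p)) :=
      H.isSquare_of_unit (u := x - 24 * p) (v := -24 * p) (c := 1) (d := 1) one_ne_zero h₃
        (by simp) h11
        (by simp only [map_sub, map_mul, map_ofNat, map_natCast, x0]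
            intro h; apply zp; linear_combination 5 * p * hk₅ + h)
        (by simp only [map_neg, map_mul, map_ofNat, map_natCast]
            intro h; apply zp; linear_combination 5 * p * hk₅ + h)
        ⟨24 * p, by simp [x0]⟩ (by simp)
    obtain ⟨w, rfl⟩ := H.exists_eq_mul x0
    by_cases w0 : π w = 0
    · right; left
      have hy : IsSquare (b₂ * (-15 * p)) :=
        H.isSquare_of_unit (u := w - 3 * p) (v := -3 * p) (c := 5) (d := 5) h50 h₂
          (by simp; ring) h55
          (by simp [w0, z3, zp]) (by simp [z3, zp])
          ⟨3 * p, by simp [w0]⟩ (by simp; ring)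
      refine ⟨?_, hy⟩
      rw [mul_comm b₁ b₂] at hz
      exact IsSquare.third hb₂ (by simp [hp0]) (by simp [hp0]) hy hz ⟨60 * p, by ring⟩
    have s3p : IsSquare (3 * p : k) := by
      have : (3 * p : k) = -1 * (2 * p) := by linear_combination p * hk₅
      rw [this]
      exact sneg.mul s2p
    right
    rcases hk (π w) with hw | hw
    · right; left
      have hx : IsSquare (b₁ * (15 * p)) :=
        H.isSquare_of_unit (u := w) (v := 3 * p) (c := 5) (d := 5) h50 h₁
          (by simp) h55 w0 (by simp [z3, zp]) (by simpa using hw.mul s3p) (by simp; ring)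
      refine ⟨hx, IsSquare.third hb₁ (by simp [hp0]) (by simp [hp0]) hx hz ?_⟩
      have : (15 * p * (-24 * p) * -15 : K) = (30 * p) ^ 2 * 6 := by ring
      rw [this]
      exact (IsSquare.sq _).mul h6
    · left
      have hx : IsSquare (b₁ * 10) :=
        H.isSquare_of_unit (u := w) (v := 2) (c := 5) (d := 5) h50 h₁
          (by simp) h55 w0 (by simp [z2]) (by simpa using hw) (by simp; norm_num)
      exact ⟨hx, IsSquare.third hb₁ (by simp) (by simp [hp0]) hx hz ⟨60 * p, by ring⟩⟩
  · have y0 : π (x - 15 * p) = π x := by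
      simp only [map_sub, map_mul, map_ofNat, map_natCast]
      linear_combination -3 * p * hk₅
    have y1 : π (x - 15 * p) ≠ 0 := by rwa [y0]
    rcases hk (π x) with hx | hx
    · left
      refine ⟨?_, ?_⟩
      · rw [← mul_one b₁]
        exact H.isSquare_of_unit (u := x) (v := 1) (c := 1) (d := 1) one_ne_zero h₁
          (by simp) h11 x0 (by simp) (by simpa using hx) (by simp)
      · rw [← mul_one b₂]
        exact H.isSquare_of_unit (u := x - 15 * p) (v := 1) (c := 1) (d := 1) one_ne_zero h₂
          (by simp) h11 y1 (by simp) (by simpa [y0] using hx) (by simp)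
    · right; right; right
      have hxp : IsSquare (π x * p) := by
        have : π x * p = π x * 2 * (2 * p) * 3 ^ 2 := by linear_combination -7 * π x * p * hk₅
        rw [this]
        exact (hx.mul s2p).mul (IsSquare.sq 3)
      refine ⟨?_, ?_⟩
      · exact H.isSquare_of_unit (u := x) (v := p) (c := 1) (d := 6) one_ne_zero h₁
          (by simp) (by rwa [one_mul]) x0 (by simpa using zp) (by simpa using hxp) (by simp)
      · exact H.isSquare_of_unit (u := x - 15 * p) (v := p) (c := 1) (d := 1) one_ne_zero h₂
          (by simp) h11 y1 (by simpa using zp) (by rw [y0]; simpa using hxp) (by simp)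

end Generic

/-- The rational number `(-1)^s 2^a 3^b 5^c p^d`. -/
def sUnit (p s a b c d : ℕ) : ℚ := (-1) ^ s * 2 ^ a * 3 ^ b * 5 ^ c * (p : ℚ) ^ d

instance fact_prime_five : Fact (Nat.Prime 5) := ⟨Nat.prime_five⟩

/-! ### Residue symbols, and square tests for S-units. -/

section Congruences

variable {p : ℕ} (hmod : p % 120 = 53 ∨ p % 120 = 77)
include hmod

theorem five_lt_of_mod : 5 < p := by omega

theorem natCast_zmod_three : (p : ZMod 3) = 2 := by
  rw [show (2 : ZMod 3) = ((2 : ℕ) : ZMod 3) from rfl, ZMod.natCast_eq_natCast_iff']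
  omega

theorem natCast_zmod_five : (p : ZMod 5) = 2 ∨ (p : ZMod 5) = 3 := by
  rw [show (2 : ZMod 5) = ((2 : ℕ) : ZMod 5) from rfl, show (3 : ZMod 5) = ((3 : ℕ) : ZMod 5) from rfl,
    ZMod.natCast_eq_natCast_iff', ZMod.natCast_eq_natCast_iff']
  omega

theorem isSquare_neg_one_zmod [Fact p.Prime] : IsSquare (-1 : ZMod p) :=
  ZMod.exists_sq_eq_neg_one_iff.2 (by omega)

theorem not_isSquare_two_zmod [Fact p.Prime] : ¬ IsSquare (2 : ZMod p) := by
  rw [ZMod.exists_sq_eq_two_iff (by omega)]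
  omega

theorem not_isSquare_three_zmod [Fact p.Prime] : ¬ IsSquare (3 : ZMod p) := by
  have h := ZMod.exists_sq_eq_prime_iff_of_mod_four_eq_one (p := p) (q := 3) (by omega) (by decide)
  rw [Nat.cast_ofNat, natCast_zmod_three hmod] at h
  rw [h]
  decide

theorem not_isSquare_five_zmod [Fact p.Prime] : ¬ IsSquare (5 : ZMod p) := by
  have h := ZMod.exists_sq_eq_prime_iff_of_mod_four_eq_one (p := p) (q := 5) (by omega) (by decide)
  rw [Nat.cast_ofNat] at h
  rw [h]
  rcases natCast_zmod_five hmod with h2 | h2 <;> rw [h2] <;> decide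

end Congruences

theorem quadraticChar_eq_one_of_isSquare {F : Type*} [Field F] [Fintype F] [DecidableEq F] {x : F}
    (hx : x ≠ 0) (h : IsSquare x) : quadraticChar F x = 1 :=
  (quadraticChar_one_iff_isSquare hx).2 h

section LocalCharacters

variable {p : ℕ} (hmod : p % 120 = 53 ∨ p % 120 = 77) {s a b c d : ℕ}
include hmod

/-- The quadratic character mod p is 1 at -1 and -1 at each of 2, 3, 5, so on the unit part it is
(-1)^(a + b + c). -/
theorem even_of_isSquare_at_p [Fact p.Prime] (h : IsSquare ((sUnit p s a b c d : ℚ) : ℚ_[p])) :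
    Even (a + b + c) ∧ Even d := by
  have n2 := not_isSquare_two_zmod hmod
  have n3 := not_isSquare_three_zmod hmod
  have n5 := not_isSquare_five_zmod hmod
  have e1 := isSquare_neg_one_zmod hmod
  have hu : PadicInt.toZMod (((-1) ^ s * 2 ^ a * 3 ^ b * 5 ^ c : ℤ) : ℤ_[p]) =
      (-1) ^ s * 2 ^ a * 3 ^ b * 5 ^ c := by
    rw [map_intCast]
    push_cast
    rfl
  have z2 : (2 : ZMod p) ≠ 0 := fun h => n2 (h ▸ ⟨0, by simp⟩)
  have z3 : (3 : ZMod p) ≠ 0 := fun h => n3 (h ▸ ⟨0, by simp⟩)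
  have z5 : (5 : ZMod p) ≠ 0 := fun h => n5 (h ▸ ⟨0, by simp⟩)
  have hu0 : ((-1) ^ s * 2 ^ a * 3 ^ b * 5 ^ c : ZMod p) ≠ 0 := by simp [z2, z3, z5]
  obtain ⟨h1, h2⟩ := even_and_isSquare_of_isSquare_mul_pow (l := p) (d := d) (by rw [hu]; exact hu0)
    (by
      have : ((sUnit p s a b c d : ℚ) : ℚ_[p]) =
        ((((-1) ^ s * 2 ^ a * 3 ^ b * 5 ^ c : ℤ) : ℤ_[p]) : ℚ_[p]) * (p : ℚ_[p]) ^ d := by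
        rw [PadicInt.coe_intCast, sUnit]
        push_cast
        rfl
      rwa [this] at h)
  rw [hu] at h1
  have h3 := quadraticChar_eq_one_of_isSquare hu0 h1
  rw [map_mul, map_mul, map_mul, map_pow, map_pow, map_pow, map_pow,
    quadraticChar_eq_one_of_isSquare (by simp) e1, quadraticChar_neg_one_iff_not_isSquare.2 n2,
    quadraticChar_neg_one_iff_not_isSquare.2 n3, quadraticChar_neg_one_iff_not_isSquare.2 n5,
    one_pow, one_mul, ← pow_add, ← pow_add, neg_one_pow_eq_one_iff_even (by norm_num)] at h3
  exact ⟨h3, h2⟩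

/-- Each of -1, 2, 5 and p is -1 mod 3. -/
theorem even_of_isSquare_at_three
    (h : IsSquare ((sUnit p s a b c d : ℚ) : ℚ_[3])) : Even (s + a + c + d) ∧ Even b := by
  have hu : PadicInt.toZMod (((-1) ^ s * 2 ^ a * 5 ^ c * (p : ℤ) ^ d : ℤ) : ℤ_[3]) =
      (-1) ^ (s + a + c + d) := by
    rw [map_intCast]
    push_cast
    rw [natCast_zmod_three hmod, show (2 : ZMod 3) = -1 by decide,
      show (5 : ZMod 3) = -1 by decide]
    ring
  obtain ⟨h1, h2⟩ := even_and_isSquare_of_isSquare_mul_pow (l := 3) (d := b)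
    (by rw [hu]; simp)
    (by
      have : ((sUnit p s a b c d : ℚ) : ℚ_[3]) =
        ((((-1) ^ s * 2 ^ a * 5 ^ c * (p : ℤ) ^ d : ℤ) : ℤ_[3]) : ℚ_[3]) *
          ((3 : ℕ) : ℚ_[3]) ^ b := by
        rw [PadicInt.coe_intCast, sUnit]
        push_cast
        ring
      rwa [this] at h)
  rw [hu] at h1
  have h3 := quadraticChar_eq_one_of_isSquare (by simp) h1
  rw [map_pow, show quadraticChar (ZMod 3) (-1) = -1 by decide,
    neg_one_pow_eq_one_iff_even (by norm_num)] at h3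
  exact ⟨h3, h2⟩

/-- Mod 5, -1 is a square and 2, 3, p are not. -/
theorem even_of_isSquare_at_five
    (h : IsSquare ((sUnit p s a b c d : ℚ) : ℚ_[5])) : Even (a + b + d) ∧ Even c := by
  have hu : PadicInt.toZMod (((-1) ^ s * 2 ^ a * 3 ^ b * (p : ℤ) ^ d : ℤ) : ℤ_[5]) =
      (-1) ^ s * 2 ^ a * 3 ^ b * (p : ZMod 5) ^ d := by
    rw [map_intCast]
    push_cast
    rfl
  have hp : (p : ZMod 5) ≠ 0 ∧ quadraticChar (ZMod 5) p = -1 := by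
    rcases natCast_zmod_five hmod with h2 | h2 <;> rw [h2] <;> decide
  have hu0 : ((-1) ^ s * 2 ^ a * 3 ^ b * (p : ZMod 5) ^ d : ZMod 5) ≠ 0 := by
    have z2 : (2 : ZMod 5) ≠ 0 := by decide
    have z3 : (3 : ZMod 5) ≠ 0 := by decide
    simp [z2, z3, hp.1]
  obtain ⟨h1, h2⟩ := even_and_isSquare_of_isSquare_mul_pow (l := 5) (d := c)
    (by rw [hu]; exact hu0)
    (by
      have : ((sUnit p s a b c d : ℚ) : ℚ_[5]) =
        ((((-1) ^ s * 2 ^ a * 3 ^ b * (p : ℤ) ^ d : ℤ) : ℤ_[5]) : ℚ_[5]) *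
          ((5 : ℕ) : ℚ_[5]) ^ c := by
        rw [PadicInt.coe_intCast, sUnit]
        push_cast
        ring
      rwa [this] at h)
  rw [hu] at h1
  have h3 := quadraticChar_eq_one_of_isSquare hu0 h1
  rw [map_mul, map_mul, map_mul, map_pow, map_pow, map_pow, map_pow, hp.2,
    show quadraticChar (ZMod 5) (-1) = 1 by decide, show quadraticChar (ZMod 5) 2 = -1 by decide,
    show quadraticChar (ZMod 5) 3 = -1 by decide,
    one_pow, one_mul, ← pow_add, ← pow_add, neg_one_pow_eq_one_iff_even (by norm_num)] at h3
  exact ⟨h3, h2⟩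

end LocalCharacters

/-- Multiplying by a torsion representative only raises exponents by one. They are left unreduced,
because the tests Q used later see only parities. -/
theorem IsTorsionClass.of_sUnit {K : Type} [Field K] [CharZero K] {p : ℕ}
    {Q : ℕ → ℕ → ℕ → ℕ → ℕ → Prop}
    (hQ : ∀ s a b c d, IsSquare ((sUnit p s a b c d : ℚ) : K) → Q s a b c d)
    {s₁ a₁ b₁ c₁ d₁ s₂ a₂ b₂ c₂ d₂ : ℕ}
    (h : IsTorsionClass p ((sUnit p s₁ a₁ b₁ c₁ d₁ : ℚ) : K) ((sUnit p s₂ a₂ b₂ c₂ d₂ : ℚ) : K)) :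
    (Q s₁ a₁ b₁ c₁ d₁ ∧ Q s₂ a₂ b₂ c₂ d₂) ∨
    (Q s₁ (a₁ + 1) b₁ (c₁ + 1) d₁ ∧ Q (s₂ + 1) a₂ (b₂ + 1) (c₂ + 1) (d₂ + 1)) ∨
    (Q s₁ a₁ (b₁ + 1) (c₁ + 1) (d₁ + 1) ∧ Q (s₂ + 1) a₂ (b₂ + 1) (c₂ + 1) d₂) ∨
    (Q s₁ (a₁ + 1) (b₁ + 1) c₁ (d₁ + 1) ∧ Q s₂ a₂ b₂ c₂ (d₂ + 1)) := by
  rcases h with h | h | h | h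
  · exact .inl ⟨hQ _ _ _ _ _ h.1, hQ _ _ _ _ _ h.2⟩
  · refine .inr (.inl ⟨hQ _ _ _ _ _ ?_, hQ _ _ _ _ _ ?_⟩)
    · convert! h.1 using 1
      simp only [sUnit]
      push_cast
      ring
    · convert! h.2 using 1
      simp only [sUnit]
      push_cast
      ring
  · refine .inr (.inr (.inl ⟨hQ _ _ _ _ _ ?_, hQ _ _ _ _ _ ?_⟩))
    · convert! h.1 using 1
      simp only [sUnit]
      push_cast
      ring
    · convert! h.2 using 1
      simp only [sUnit]
      push_cast
      ring
  · refine .inr (.inr (.inr ⟨hQ _ _ _ _ _ ?_, hQ _ _ _ _ _ ?_⟩))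
    · convert! h.1 using 1
      simp only [sUnit]
      push_cast
      ring
    · convert! h.2 using 1
      simp only [sUnit]
      push_cast
      ring

/-! ### Soluble pairs at p, 3, 5 are torsion classes. -/

section HasPoint

variable {p : ℕ} {b₁ b₂ : ℚˣ}

theorem HasPoint.exists_isSquare {K : Type} [Field K] (h : HasPoint K p b₁ b₂) :
    ∃ x : K, IsSquare (((b₁ : ℚ) : K) * x) ∧ IsSquare (((b₂ : ℚ) : K) * (x - 15 * p)) ∧
      IsSquare (((b₁ : ℚ) : K) * ((b₂ : ℚ) : K) * (x - 24 * p)) := by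
  obtain ⟨z₁, z₂, z₃, h₁, h₂⟩ := h
  refine ⟨((b₁ : ℚ) : K) * z₁ ^ 2, ⟨((b₁ : ℚ) : K) * z₁, by ring⟩, ⟨((b₂ : ℚ) : K) * z₂, ?_⟩,
    ⟨((b₁ : ℚ) : K) * ((b₂ : ℚ) : K) * z₃, ?_⟩⟩
  · rw [← h₁]
    ring
  · rw [← h₂]
    ring

variable (hmod : p % 120 = 53 ∨ p % 120 = 77)
include hmod

theorem HasPoint.isTorsionClass_p [Fact p.Prime] (h : HasPoint ℚ_[p] p b₁ b₂) :
    IsTorsionClass p ((b₁ : ℚ) : ℚ_[p]) ((b₂ : ℚ) : ℚ_[p]) := by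
  have hp := five_lt_of_mod hmod
  have hb₁ : ((b₁ : ℚ) : ℚ_[p]) ≠ 0 := by exact_mod_cast b₁.ne_zero
  have hb₂ : ((b₂ : ℚ) : ℚ_[p]) ≠ 0 := by exact_mod_cast b₂.ne_zero
  obtain ⟨x, h₁, h₂, h₃⟩ := h.exists_isSquare
  have H := oddLocal_padic (l := p) (by omega)
  by_cases hx : ‖x‖ ≤ ‖(p : ℚ_[p])‖
  · obtain ⟨u, rfl⟩ := exists_eq_prime_mul hx
    refine isTorsionClass_at_self hb₁ hb₂ H ?_ ?_ ?_ h₁ h₂ h₃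
    · exact fun h => not_isSquare_two_zmod hmod (h ▸ ⟨0, by simp⟩)
    · exact fun h => not_isSquare_three_zmod hmod (h ▸ ⟨0, by simp⟩)
    · exact fun h => not_isSquare_five_zmod hmod (h ▸ ⟨0, by simp⟩)
  · push Not at hx
    exact .inl (isSquare_of_norm_lt (by omega) hb₁ hb₂ h₁ h₂ h₃
      ((norm_natCast_mul_le 15).trans_lt hx) ((norm_natCast_mul_le 24).trans_lt hx))

theorem HasPoint.isTorsionClass_three (h : HasPoint ℚ_[3] p b₁ b₂) :
    IsTorsionClass p ((b₁ : ℚ) : ℚ_[3]) ((b₂ : ℚ) : ℚ_[3]) := by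
  have hb₁ : ((b₁ : ℚ) : ℚ_[3]) ≠ 0 := by exact_mod_cast b₁.ne_zero
  have hb₂ : ((b₂ : ℚ) : ℚ_[3]) ≠ 0 := by exact_mod_cast b₂.ne_zero
  obtain ⟨x, h₁, h₂, h₃⟩ := h.exists_isSquare
  have H := oddLocal_padic (l := 3) (by decide)
  by_cases hx : ‖x‖ ≤ ‖((3 : ℕ) : ℚ_[3])‖
  · obtain ⟨u, rfl⟩ := exists_eq_prime_mul hx
    exact isTorsionClass_at_three hb₁ hb₂ H (by decide) (natCast_zmod_three hmod)
      (by decide) h₁ h₂ h₃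
  · push Not at hx
    have h1 := (norm_natCast_mul_le (l := 3) (5 * p)).trans_lt hx
    have h2 := (norm_natCast_mul_le (l := 3) (8 * p)).trans_lt hx
    refine .inl (isSquare_of_norm_lt (by decide) hb₁ hb₂ h₁ h₂ h₃ ?_ ?_)
    · convert! h1 using 2
      push_cast
      ring
    · convert! h2 using 2
      push_cast
      ring

theorem HasPoint.isTorsionClass_five (h : HasPoint ℚ_[5] p b₁ b₂) :
    IsTorsionClass p ((b₁ : ℚ) : ℚ_[5]) ((b₂ : ℚ) : ℚ_[5]) := by
  have hb₁ : ((b₁ : ℚ) : ℚ_[5]) ≠ 0 := by exact_mod_cast b₁.ne_zero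
  have hb₂ : ((b₂ : ℚ) : ℚ_[5]) ≠ 0 := by exact_mod_cast b₂.ne_zero
  obtain ⟨x, h₁, h₂, h₃⟩ := h.exists_isSquare
  have H := oddLocal_padic (l := 5) (by decide)
  by_cases hx : ‖x‖ ≤ 1
  · exact isTorsionClass_at_five (x := ⟨x, hx⟩) hb₁ hb₂ H (by decide) (natCast_zmod_five hmod)
      (by decide) h₁ h₂ h₃
  · push Not at hx
    have h1 := (Padic.norm_int_le_one (p := 5) (15 * p)).trans_lt hx
    have h2 := (Padic.norm_int_le_one (p := 5) (24 * p)).trans_lt hx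
    refine .inl (isSquare_of_norm_lt (by decide) hb₁ hb₂ h₁ h₂ h₃ ?_ ?_)
    · convert! h1 using 2
      push_cast
      rfl
    · convert! h2 using 2
      push_cast
      rfl

end HasPoint

/-! ### Insolubility at 2 of the coset of (1, 6). -/

section TwoAdic

/-- The valuation of 2w² is odd and that of z² is even. -/
theorem norm_two_mul_sq_ne {z w : ℚ_[2]} (hz : z ≠ 0) : ‖2 * w ^ 2‖ ≠ ‖z ^ 2‖ := by
  intro h
  have hw : w ≠ 0 := by
    rintro rfl
    rw [zero_pow two_ne_zero, mul_zero, norm_zero] at h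
    exact (norm_pos_iff.2 (pow_ne_zero 2 hz)).ne h
  have h2 : (2 : ℚ_[2]) ≠ 0 := two_ne_zero
  rw [Padic.norm_eq_zpow_neg_valuation (mul_ne_zero h2 (pow_ne_zero 2 hw)),
    Padic.norm_eq_zpow_neg_valuation (pow_ne_zero 2 hz),
    Padic.valuation_mul h2 (pow_ne_zero 2 hw), Padic.valuation_pow, Padic.valuation_pow] at h
  have h3 := zpow_right_injective₀ (by norm_num) (by norm_num) h
  have h4 : (2 : ℚ_[2]).valuation = 1 := Padic.valuation_p (p := 2)
  rw [h4] at h3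
  push_cast at h3
  omega

/-- By parity the two terms have different norms and cannot cancel, so each is bounded by the sum.
-/
theorem norm_sq_le_of_add_two_mul_sq {u v z w c : ℚ_[2]} (hu : ‖u‖ = 1) (hv : ‖v‖ = 1)
    (h : u * z ^ 2 + 2 * v * w ^ 2 = c) : ‖z ^ 2‖ ≤ ‖c‖ := by
  rcases eq_or_ne z 0 with rfl | hz
  · rw [zero_pow two_ne_zero, norm_zero]
    exact norm_nonneg c
  · have h1 : ‖u * z ^ 2‖ = ‖z ^ 2‖ := by rw [norm_mul, hu, one_mul]
    have h2 : ‖2 * v * w ^ 2‖ = ‖2 * w ^ 2‖ := by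
      rw [norm_mul, norm_mul, norm_mul, hv, mul_one]
    rw [← h, Padic.add_eq_max_of_ne (by rw [h1, h2]; exact (norm_two_mul_sq_ne hz).symm), h1]
    exact le_max_left _ _

theorem two_mul_sq_ne_of_norm_lt_one {v w n e : ℚ_[2]} (hv : ‖v‖ = 1) (hn : ‖n‖ = 1)
    (he : ‖e‖ < 1) : 2 * v * w ^ 2 ≠ n + e := by
  intro h
  have h1 : ‖n + e‖ = 1 := by
    rw [Padic.add_eq_max_of_ne (by rw [hn]; exact he.ne'), hn, max_eq_left he.le]
  apply norm_two_mul_sq_ne (z := 1) (w := w) one_ne_zero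
  rw [one_pow, norm_one, ← h1, ← h, norm_mul, norm_mul, norm_mul, hv, mul_one]

theorem norm_natCast_of_odd {n : ℕ} (hn : n % 2 = 1) : ‖(n : ℚ_[2])‖ = 1 :=
  Padic.norm_natCast_eq_one_iff.2 (Nat.coprime_two_left.2 (Nat.odd_iff.2 hn))

theorem norm_natCast_lt_of_even {n : ℕ} (hn : n % 2 = 0) : ‖(n : ℚ_[2])‖ < 1 :=
  Padic.norm_natCast_lt_one_iff.2 (Nat.dvd_of_mod_eq_zero hn)

variable {p : ℕ} (hp : p % 2 = 1) {b₁ b₂ : ℚˣ}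
include hp

/-- The pattern for all four pairs: the second equation, with even right-hand side, forces |z₁²| <
1. The first then equates 2·unit·z₂² with a unit, contradicting parity of valuations. -/
theorem not_hasPoint_two_one_six (hb₁ : (b₁ : ℚ) = 1) (hb₂ : (b₂ : ℚ) = 6) :
    ¬ HasPoint ℚ_[2] p b₁ b₂ := by
  rintro ⟨z₁, z₂, z₃, h₁, h₂⟩
  rw [hb₁, hb₂] at h₁ h₂
  push_cast at h₁ h₂
  have n3 : ‖((3 : ℕ) : ℚ_[2])‖ = 1 := norm_natCast_of_odd rfl
  have n15p : ‖((15 * p : ℕ) : ℚ_[2])‖ = 1 := norm_natCast_of_odd (by omega)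
  have hz : ‖z₁ ^ 2‖ < 1 :=
    (norm_sq_le_of_add_two_mul_sq (u := 1) (v := -((3 : ℕ) : ℚ_[2])) (w := z₃)
      (c := ((24 * p : ℕ) : ℚ_[2])) norm_one (by rwa [norm_neg])
      (by push_cast; linear_combination h₂)).trans_lt (norm_natCast_lt_of_even (by omega))
  refine two_mul_sq_ne_of_norm_lt_one (v := ((3 : ℕ) : ℚ_[2])) (w := z₂)
    (n := -((15 * p : ℕ) : ℚ_[2])) n3 (by rwa [norm_neg]) hz ?_
  push_cast
  linear_combination -h₁

theorem not_hasPoint_two_six_p (hb₁ : (b₁ : ℚ) = 6 * p) (hb₂ : (b₂ : ℚ) = 6 * p) :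
    ¬ HasPoint ℚ_[2] p b₁ b₂ := by
  rintro ⟨z₁, z₂, z₃, h₁, h₂⟩
  rw [hb₁, hb₂] at h₁ h₂
  push_cast at h₁ h₂
  have hp0 : (p : ℚ_[2]) ≠ 0 := by
    rw [Nat.cast_ne_zero]
    omega
  have h₁' : 2 * z₁ ^ 2 - 2 * z₂ ^ 2 = 5 :=
    mul_left_cancel₀ (mul_ne_zero (three_ne_zero (α := ℚ_[2])) hp0) (by linear_combination h₁)
  have h₂' : z₁ ^ 2 - 6 * p * z₃ ^ 2 = 4 :=
    mul_left_cancel₀ (mul_ne_zero (by norm_num : (6 : ℚ_[2]) ≠ 0) hp0) (by linear_combination h₂)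
  have hz : ‖z₁ ^ 2‖ < 1 :=
    (norm_sq_le_of_add_two_mul_sq (u := 1) (v := -((3 * p : ℕ) : ℚ_[2])) (w := z₃)
      (c := ((4 : ℕ) : ℚ_[2])) norm_one (by rw [norm_neg]; exact norm_natCast_of_odd (by omega))
      (by push_cast; linear_combination h₂')).trans_lt (norm_natCast_lt_of_even rfl)
  refine two_mul_sq_ne_of_norm_lt_one (v := 1) (w := z₂)
    (n := -((5 : ℕ) : ℚ_[2])) (e := ((2 : ℕ) : ℚ_[2]) * z₁ ^ 2) norm_one
    (by rw [norm_neg]; exact norm_natCast_of_odd rfl) ?_ ?_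
  · rw [norm_mul]
    exact mul_lt_one_of_nonneg_of_lt_one_left (norm_nonneg _) (norm_natCast_lt_of_even rfl) hz.le
  · push_cast
    linear_combination -h₁'

theorem not_hasPoint_two_ten (hb₁ : (b₁ : ℚ) = 10) (hb₂ : (b₂ : ℚ) = -10 * p) :
    ¬ HasPoint ℚ_[2] p b₁ b₂ := by
  rintro ⟨z₁, z₂, z₃, h₁, h₂⟩
  rw [hb₁, hb₂] at h₁ h₂
  push_cast at h₁ h₂
  have h₁' : 2 * z₁ ^ 2 + 2 * p * z₂ ^ 2 = 3 * p :=
    mul_left_cancel₀ (by norm_num : (5 : ℚ_[2]) ≠ 0) (by linear_combination h₁)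
  have h₂' : 5 * z₁ ^ 2 + 50 * p * z₃ ^ 2 = 12 * p :=
    mul_left_cancel₀ (by norm_num : (2 : ℚ_[2]) ≠ 0) (by linear_combination h₂)
  have hz : ‖z₁ ^ 2‖ < 1 :=
    (norm_sq_le_of_add_two_mul_sq (u := ((5 : ℕ) : ℚ_[2])) (v := ((25 * p : ℕ) : ℚ_[2])) (w := z₃)
      (c := ((12 * p : ℕ) : ℚ_[2])) (norm_natCast_of_odd rfl) (norm_natCast_of_odd (by omega))
      (by push_cast; linear_combination h₂')).trans_lt (norm_natCast_lt_of_even (by omega))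
  refine two_mul_sq_ne_of_norm_lt_one (v := (p : ℚ_[2])) (w := z₂)
    (n := ((3 * p : ℕ) : ℚ_[2])) (e := -((2 : ℕ) : ℚ_[2]) * z₁ ^ 2) (norm_natCast_of_odd hp)
    (norm_natCast_of_odd (by omega)) ?_ ?_
  · rw [norm_mul, norm_neg]
    exact mul_lt_one_of_nonneg_of_lt_one_left (norm_nonneg _) (norm_natCast_lt_of_even rfl) hz.le
  · push_cast
    linear_combination h₁'

theorem not_hasPoint_two_fifteen_p (hb₁ : (b₁ : ℚ) = 15 * p) (hb₂ : (b₂ : ℚ) = -10) :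
    ¬ HasPoint ℚ_[2] p b₁ b₂ := by
  rintro ⟨z₁, z₂, z₃, h₁, h₂⟩
  rw [hb₁, hb₂] at h₁ h₂
  push_cast at h₁ h₂
  have hp0 : (p : ℚ_[2]) ≠ 0 := by
    rw [Nat.cast_ne_zero]
    omega
  have h₁' : 3 * p * z₁ ^ 2 + 2 * z₂ ^ 2 = 3 * p :=
    mul_left_cancel₀ (by norm_num : (5 : ℚ_[2]) ≠ 0) (by linear_combination h₁)
  have h₂' : 5 * z₁ ^ 2 + 50 * z₃ ^ 2 = 8 :=
    mul_left_cancel₀ (mul_ne_zero (three_ne_zero (α := ℚ_[2])) hp0) (by linear_combination h₂)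
  have n3p : ‖((3 * p : ℕ) : ℚ_[2])‖ = 1 := norm_natCast_of_odd (by omega)
  have hz : ‖z₁ ^ 2‖ < 1 :=
    (norm_sq_le_of_add_two_mul_sq (u := ((5 : ℕ) : ℚ_[2])) (v := ((25 : ℕ) : ℚ_[2])) (w := z₃)
      (c := ((8 : ℕ) : ℚ_[2])) (norm_natCast_of_odd rfl) (norm_natCast_of_odd rfl)
      (by push_cast; linear_combination h₂')).trans_lt (norm_natCast_lt_of_even rfl)
  refine two_mul_sq_ne_of_norm_lt_one (v := 1) (w := z₂)
    (n := ((3 * p : ℕ) : ℚ_[2])) (e := -((3 * p : ℕ) : ℚ_[2]) * z₁ ^ 2) norm_one n3p ?_ ?_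
  · rwa [norm_mul, norm_neg, n3p, one_mul]
  · push_cast
    linear_combination h₁'

end TwoAdic

/-! ### The real place, and the combination of all local conditions. -/

/-- If b₁ ≤ 0, the first equation forces b₂ < 0. Then b₁b₂ ≥ 0 and the second left-hand side is
nonpositive. -/
theorem pos_of_hasPoint_real {p : ℕ} (hp : 0 < p) {b₁ b₂ : ℚˣ} (h : HasPoint ℝ p b₁ b₂) :
    0 < (b₁ : ℚ) := by
  obtain ⟨z₁, z₂, z₃, h₁, h₂⟩ := h
  by_contra hb
  have hb₁ : ((b₁ : ℚ) : ℝ) ≤ 0 := by exact_mod_cast not_lt.1 hb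
  have hp' : (0 : ℝ) < p := by exact_mod_cast hp
  have h3 := mul_nonneg (neg_nonneg.2 hb₁) (sq_nonneg z₁)
  have hb₂ : ((b₂ : ℚ) : ℝ) ≤ 0 := by
    by_contra hb
    have := mul_nonneg (not_le.1 hb).le (sq_nonneg z₂)
    linarith
  have h4 := mul_nonneg (mul_nonneg_of_nonpos_of_nonpos hb₁ hb₂) (sq_nonneg z₃)
  linarith

/-- The linear algebra over `𝔽₂` of the conditions at `∞`, `p`, `3` and `5`. -/
theorem exponents_of_parities : ∀ s₁ a₁ b₁ c₁ d₁ s₂ a₂ b₂ c₂ d₂ : Bool,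
    s₁ = false →
    (a₁.toNat + b₁.toNat + c₁.toNat) % 2 = 0 → (a₂.toNat + b₂.toNat + c₂.toNat) % 2 = 0 →
    (s₁.toNat + a₁.toNat + c₁.toNat + d₁.toNat) % 2 = 0 →
    (s₂.toNat + a₂.toNat + c₂.toNat + d₂.toNat + b₁.toNat + b₂.toNat) % 2 = 0 →
    (c₁.toNat + c₂.toNat) % 2 = 0 →
    (a₁.toNat + b₁.toNat + d₁.toNat + a₂.toNat + b₂.toNat + d₂.toNat + c₁.toNat) % 2 = 0 →
    (a₁, b₁, c₁, d₁, s₂, a₂, b₂, c₂, d₂) ∈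
      ([(false, false, false, false, false, false, false, false, false),
        (true, false, true, false, true, false, true, true, true),
        (false, true, true, true, true, false, true, true, false),
        (true, true, false, true, false, false, false, false, true),
        (false, false, false, false, false, true, true, false, false),
        (true, true, false, true, false, true, true, false, true),
        (true, false, true, false, true, true, false, true, true),
        (false, true, true, true, true, true, false, true, false)] :
        List (Bool × Bool × Bool × Bool × Bool × Bool × Bool × Bool × Bool)) := by
  decide

section Classes

variable {p : ℕ} (hmod : p % 120 = 53 ∨ p % 120 = 77) {β₁ β₂ : ℚˣ}
  {s₁ a₁ b₁ c₁ d₁ s₂ a₂ b₂ c₂ d₂ : Bool}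
include hmod

/-- The four classes of pairs with points everywhere locally, in terms of exponents. -/
theorem eq_of_everywhereLocallySoluble [Fact p.Prime]
    (hβ₁ : (β₁ : ℚ) = sUnit p s₁.toNat a₁.toNat b₁.toNat c₁.toNat d₁.toNat)
    (hβ₂ : (β₂ : ℚ) = sUnit p s₂.toNat a₂.toNat b₂.toNat c₂.toNat d₂.toNat)
    (h : EverywhereLocallySoluble p β₁ β₂) :
    ((β₁ : ℚ) = 1 ∧ (β₂ : ℚ) = 1) ∨ ((β₁ : ℚ) = 10 ∧ (β₂ : ℚ) = -15 * p) ∨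
    ((β₁ : ℚ) = 15 * p ∧ (β₂ : ℚ) = -15) ∨ ((β₁ : ℚ) = 6 * p ∧ (β₂ : ℚ) = p) := by
  have hp5 := five_lt_of_mod hmod
  have hs : s₁ = false := by
    have h0 := pos_of_hasPoint_real (by omega) h.1
    rw [hβ₁] at h0
    by_contra hs
    rw [Bool.not_eq_false] at hs
    subst hs
    have hp' : (0 : ℚ) < p := by
      have : 0 < p := by omega
      exact_mod_cast this
    have : (0 : ℚ) < 2 ^ a₁.toNat * 3 ^ b₁.toNat * 5 ^ c₁.toNat * (p : ℚ) ^ d₁.toNat := by positivity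
    simp only [sUnit, Bool.toNat_true, pow_one] at h0
    linarith
  have tp := HasPoint.isTorsionClass_p hmod (h.2 p)
  have t3 := HasPoint.isTorsionClass_three hmod (h.2 3)
  have t5 := HasPoint.isTorsionClass_five hmod (h.2 5)
  rw [hβ₁, hβ₂] at tp t3 t5
  replace tp := tp.of_sUnit fun _ _ _ _ _ => even_of_isSquare_at_p hmod
  replace t3 := t3.of_sUnit fun _ _ _ _ _ => even_of_isSquare_at_three hmod
  replace t5 := t5.of_sUnit fun _ _ _ _ _ => even_of_isSquare_at_five hmod
  simp only [Nat.even_iff] at tp t3 t5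
  have h2 := h.2 2
  -- The torsion image is a plane in the four-dimensional space of local pairs of classes, so two
  -- equations cut it out. All four alternatives satisfy them; the same holds at 3 and 5.
  have ep : (a₁.toNat + b₁.toNat + c₁.toNat) % 2 = 0 ∧
      (a₂.toNat + b₂.toNat + c₂.toNat) % 2 = 0 := by
    clear t3 t5
    rcases tp with ⟨⟨h1, h2⟩, h3, h4⟩ | ⟨⟨h1, h2⟩, h3, h4⟩ | ⟨⟨h1, h2⟩, h3, h4⟩ | ⟨⟨h1, h2⟩, h3, h4⟩ <;>
      omega
  have e3 : (s₁.toNat + a₁.toNat + c₁.toNat + d₁.toNat) % 2 = 0 ∧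
      (s₂.toNat + a₂.toNat + c₂.toNat + d₂.toNat + b₁.toNat + b₂.toNat) % 2 = 0 := by
    clear tp t5
    rcases t3 with ⟨⟨h1, h2⟩, h3, h4⟩ | ⟨⟨h1, h2⟩, h3, h4⟩ | ⟨⟨h1, h2⟩, h3, h4⟩ | ⟨⟨h1, h2⟩, h3, h4⟩ <;>
      omega
  have e5 : (c₁.toNat + c₂.toNat) % 2 = 0 ∧
      (a₁.toNat + b₁.toNat + d₁.toNat + a₂.toNat + b₂.toNat + d₂.toNat + c₁.toNat) % 2 = 0 := by
    clear tp t3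
    rcases t5 with ⟨⟨h1, h2⟩, h3, h4⟩ | ⟨⟨h1, h2⟩, h3, h4⟩ | ⟨⟨h1, h2⟩, h3, h4⟩ | ⟨⟨h1, h2⟩, h3, h4⟩ <;>
      omega
  have key := exponents_of_parities s₁ a₁ b₁ c₁ d₁ s₂ a₂ b₂ c₂ d₂ hs ep.1 ep.2 e3.1 e3.2 e5.1 e5.2
  simp only [List.mem_cons, Prod.mk.injEq, List.not_mem_nil, or_false] at key
  have hp2 : p % 2 = 1 := by omega
  subst hs
  -- The first four solutions are the torsion classes; the last four are their translates by (1, 6).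
  rcases key with h | h | h | h | h | h | h | h <;>
    obtain ⟨rfl, rfl, rfl, rfl, rfl, rfl, rfl, rfl, rfl⟩ := h <;>
    norm_num [sUnit] at hβ₁ hβ₂
  · exact .inl ⟨by rw [hβ₁, Units.val_one], by rw [hβ₂, Units.val_one]⟩
  · exact .inr (.inl ⟨hβ₁, by linarith⟩)
  · exact .inr (.inr (.inl ⟨hβ₁, hβ₂⟩))
  · exact .inr (.inr (.inr ⟨hβ₁, hβ₂⟩))
  · exact absurd h2 (not_hasPoint_two_one_six hp2 (by rw [hβ₁, Units.val_one]) hβ₂)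
  · exact absurd h2 (not_hasPoint_two_six_p hp2 hβ₁ hβ₂)
  · exact absurd h2 (not_hasPoint_two_ten hp2 hβ₁ (by linarith))
  · exact absurd h2 (not_hasPoint_two_fifteen_p hp2 hβ₁ hβ₂)

end Classes

/-! ### S-unit representatives of the classes in ℚ(S, 2). -/

theorem isSquare_nat_of_even_padicValNat {n : ℕ} (hn : n ≠ 0)
    (h : ∀ l : ℕ, l.Prime → Even (padicValNat l n)) : IsSquare n := by
  obtain ⟨a, b, hab, ha⟩ := Nat.sq_mul_squarefree n
  have hb0 : b ≠ 0 := by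
    rintro rfl
    simp at hab
    exact hn hab.symm
  have ha1 : a = 1 := by
    by_contra h1
    obtain ⟨l, hl, hla⟩ := Nat.exists_prime_and_dvd h1
    have : Fact l.Prime := ⟨hl⟩
    have ha0 : a ≠ 0 := ha.ne_zero
    have h2 := h l hl
    rw [← hab, padicValNat.mul (pow_ne_zero 2 hb0) ha0, padicValNat.pow, Nat.even_add] at h2
    have h3 : padicValNat l a = 1 := by
      have h4 := one_le_padicValNat_of_dvd ha0 hla
      have h5 : ¬ l ^ 2 ∣ a := fun h6 => hl.one_lt.ne' (Nat.isUnit_iff.1 (ha l (by rwa [← sq])))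
      rw [padicValNat_dvd_iff_le ha0] at h5
      omega
    rw [h3] at h2
    simp at h2
  rw [← hab, ha1, mul_one]
  exact IsSquare.sq b

theorem isSquare_rat_of_even_padicValRat {q : ℚ} (hq : 0 < q)
    (h : ∀ l : ℕ, l.Prime → Even (padicValRat l q)) : IsSquare q := by
  have hd : (q.den : ℚ) ≠ 0 := by exact_mod_cast q.den_ne_zero
  have hn : 0 < q.num := Rat.num_pos.2 hq
  obtain ⟨m, hm⟩ : ∃ m : ℕ, q.num = m := ⟨q.num.toNat, by omega⟩
  have hqe : q * (q.den : ℚ) ^ 2 = ((m * q.den : ℕ) : ℚ) := by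
    push_cast
    have h1 : (q.num : ℚ) = m := by exact_mod_cast hm
    rw [← h1, sq, ← mul_assoc, Rat.mul_den_eq_num]
  have hm0 : m ≠ 0 := by
    rintro rfl
    omega
  obtain ⟨r, hr⟩ := isSquare_nat_of_even_padicValNat (mul_ne_zero hm0 q.den_ne_zero) fun l hl => by
    have : Fact l.Prime := ⟨hl⟩
    have h1 : Even (padicValRat l (q * (q.den : ℚ) ^ 2)) := by
      rw [padicValRat.mul hq.ne' (pow_ne_zero 2 hd), padicValRat.pow]
      exact (h l hl).add (even_two.mul_right _)
    rw [hqe, padicValRat.of_nat] at h1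
    exact_mod_cast h1
  refine IsSquare.of_mul_right (pow_ne_zero 2 hd) ?_ (IsSquare.sq _)
  rw [hqe, hr]
  exact ⟨r, by push_cast; ring⟩

theorem padicValRat_prime_of_ne {l q : ℕ} (hl : l.Prime) (hq : q.Prime) (h : l ≠ q) :
    padicValRat l (q : ℚ) = 0 := by
  have : Fact l.Prime := ⟨hl⟩
  have : Fact q.Prime := ⟨hq⟩
  rw [padicValRat.of_nat, padicValNat_primes h, Nat.cast_zero]

/-- A prime can be removed from `S` after multiplying by a power of it. -/
theorem exists_mul_pow_mem_evenOutside {S : Set ℕ} {q : ℕ} (hq : q.Prime) {u : ℚˣ}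
    (hu : u ∈ evenOutside (insert q S)) :
    ∃ (a : Bool) (v : ℚˣ), v ∈ evenOutside S ∧ (v : ℚ) = u * (q : ℚ) ^ a.toNat := by
  have hq0 : (q : ℚ) ≠ 0 := by exact_mod_cast hq.ne_zero
  obtain ⟨a, ha⟩ : ∃ a : Bool, Even (padicValRat q (u : ℚ) + a.toNat) := by
    rcases Int.even_or_odd (padicValRat q (u : ℚ)) with h | h
    · exact ⟨false, by simpa using h⟩
    · exact ⟨true, by simpa using h.add_one⟩
  refine ⟨a, u * (Units.mk0 (q : ℚ) hq0) ^ a.toNat, ?_, by simp⟩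
  intro l hl hlS
  have : Fact l.Prime := ⟨hl⟩
  have : Fact q.Prime := ⟨hq⟩
  rw [Units.val_mul, Units.val_pow_eq_pow_val, Units.val_mk0,
    padicValRat.mul u.ne_zero (pow_ne_zero _ hq0), padicValRat.pow]
  by_cases hlq : l = q
  · subst hlq
    rwa [padicValRat.self hl.one_lt, mul_one]
  · rw [padicValRat_prime_of_ne hl hq hlq, mul_zero, add_zero]
    exact hu l hl (by simp [hlq, hlS])

theorem exists_sUnit_of_mem {p : ℕ} (hp : p.Prime) {u : ℚˣ} (hu : u ∈ evenOutside (badPrimes p)) :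
    ∃ (s a b c d : Bool) (w : ℚˣ),
      ((u * w ^ 2 : ℚˣ) : ℚ) = sUnit p s.toNat a.toNat b.toNat c.toNat d.toNat := by
  have hp0 : (p : ℚ) ≠ 0 := by exact_mod_cast hp.ne_zero
  obtain ⟨d, v₁, hv₁, e₁⟩ := exists_mul_pow_mem_evenOutside hp hu
  obtain ⟨a, v₂, hv₂, e₂⟩ := exists_mul_pow_mem_evenOutside Nat.prime_two hv₁
  obtain ⟨b, v₃, hv₃, e₃⟩ := exists_mul_pow_mem_evenOutside Nat.prime_three hv₂
  -- Writing {5} as `insert 5 ∅` lets the last removal leave no exceptional prime, so v₄ is plus or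
  -- minus a square.
  rw [← insert_empty_eq] at hv₃
  obtain ⟨c, v₄, hv₄, e₄⟩ := exists_mul_pow_mem_evenOutside Nat.prime_five hv₃
  have key : ∀ q : ℚ, 0 < q → q = v₄ ∨ q = -v₄ → IsSquare q := by
    intro q hq h
    refine isSquare_rat_of_even_padicValRat hq fun l hl => ?_
    have h1 := hv₄ l hl (by simp)
    rcases h with rfl | rfl
    · exact h1
    · rwa [padicValRat.neg]
  obtain ⟨s, r, hr⟩ : ∃ (s : Bool) (r : ℚ), (v₄ : ℚ) = (-1) ^ s.toNat * (r * r) := by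
    rcases lt_or_gt_of_ne v₄.ne_zero with h | h
    · obtain ⟨r, hr⟩ := key (-v₄) (by linarith) (.inr rfl)
      exact ⟨true, r, by rw [← hr]; simp⟩
    · obtain ⟨r, hr⟩ := key v₄ h (.inl rfl)
      exact ⟨false, r, by rw [← hr]; simp⟩
  have hr0 : r ≠ 0 := by
    rintro rfl
    exact v₄.ne_zero (by rw [hr]; simp)
  let y : ℚ := 2 ^ a.toNat * 3 ^ b.toNat * 5 ^ c.toNat * (p : ℚ) ^ d.toNat
  have hy : y ≠ 0 := by positivity
  refine ⟨s, a, b, c, d, Units.mk0 (y / r) (div_ne_zero hy hr0), ?_⟩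
  rw [Units.val_mul, Units.val_pow_eq_pow_val, Units.val_mk0]
  have h1 : (u : ℚ) * y = (-1) ^ s.toNat * (r * r) := by
    rw [← hr, e₄, e₃, e₂, e₁]
    push_cast
    ring
  have h2 : sUnit p s.toNat a.toNat b.toNat c.toNat d.toNat = (-1) ^ s.toNat * y := by
    simp only [sUnit, y]
    ring
  rw [h2, div_pow]
  field_simp
  linear_combination h1

theorem padicValRat_sUnit {p : ℕ} (hp : p.Prime) {l : ℕ} (hl : l.Prime) (hlS : l ∉ badPrimes p)
    (s a b c d : ℕ) : padicValRat l (sUnit p s a b c d) = 0 := by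
  have : Fact l.Prime := ⟨hl⟩
  simp only [badPrimes, Set.mem_insert_iff, Set.mem_singleton_iff, not_or] at hlS
  have hp0 : (p : ℚ) ≠ 0 := by exact_mod_cast hp.ne_zero
  have h2 := padicValRat_prime_of_ne hl Nat.prime_two hlS.2.1
  have h3 := padicValRat_prime_of_ne hl Nat.prime_three hlS.2.2.1
  have h5 := padicValRat_prime_of_ne hl Nat.prime_five hlS.2.2.2
  have hpp := padicValRat_prime_of_ne hl hp hlS.1
  rw [Nat.cast_ofNat] at h2 h3 h5
  rw [sUnit, padicValRat.mul (by positivity) (by positivity),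
    padicValRat.mul (by positivity) (by positivity), padicValRat.mul (by positivity) (by positivity),
    padicValRat.mul (by positivity) (by positivity), padicValRat.pow, padicValRat.pow,
    padicValRat.pow, padicValRat.pow, padicValRat.pow, h2, h3, h5, hpp, padicValRat.neg,
    padicValRat.one]
  simp

theorem mem_evenOutside_of_eq_sUnit {p : ℕ} (hp : p.Prime) {u : ℚˣ} {s a b c d : ℕ}
    (hu : (u : ℚ) = sUnit p s a b c d) : u ∈ evenOutside (badPrimes p) := by
  intro l hl hlS
  rw [hu, padicValRat_sUnit hp hl hlS]
  exact Even.zero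

section SquareClass

/-- The square class of a nonzero rational number (and the trivial class for `0`). -/
noncomputable def ratClass (q : ℚ) : SquareClass :=
  if h : q = 0 then 1 else ((Units.mk0 q h : ℚˣ) : SquareClass)

theorem mk_eq_ratClass {u : ℚˣ} {q : ℚ} (h : (u : ℚ) = q) : (u : SquareClass) = ratClass q := by
  subst h
  rw [ratClass, dif_neg u.ne_zero, Units.mk0_val]

theorem mk_eq_mk_iff {u v : ℚˣ} : (u : SquareClass) = v ↔ ∃ w : ℚˣ, v = u * w ^ 2 := by
  rw [QuotientGroup.eq, MonoidHom.mem_range]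
  constructor
  · rintro ⟨w, hw⟩
    exact ⟨w, by rw [← powMonoidHom_apply, hw, mul_inv_cancel_left]⟩
  · rintro ⟨w, rfl⟩
    exact ⟨w, by simp⟩

theorem isSquare_of_ratClass_eq {q r : ℚ} (hq : q ≠ 0) (hr : r ≠ 0)
    (h : ratClass q = ratClass r) : IsSquare (q * r) := by
  rw [ratClass, ratClass, dif_neg hq, dif_neg hr, mk_eq_mk_iff] at h
  obtain ⟨w, hw⟩ := h
  have h1 : r = q * (w : ℚ) ^ 2 := by
    have := congrArg (Units.val) hw
    simpa using this
  exact ⟨q * w, by rw [h1]; ring⟩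

end SquareClass

theorem EverywhereLocallySoluble.mul_sq {p : ℕ} {b₁ b₂ : ℚˣ} (h : EverywhereLocallySoluble p b₁ b₂)
    (c₁ c₂ : ℚˣ) : EverywhereLocallySoluble p (b₁ * c₁ ^ 2) (b₂ * c₂ ^ 2) :=
  ⟨h.1.mul_sq c₁ c₂, fun l _ => (h.2 l).mul_sq c₁ c₂⟩

/-- Newton iteration starts at 1, where the derivative is 2; the bound |2|² also covers l = 2. -/
theorem isSquare_one_sub_of_norm_lt {l : ℕ} [Fact l.Prime] {m : ℤ_[l]}
    (h : ‖m‖ < ‖(2 : ℤ_[l])‖ ^ 2) : IsSquare (1 - m : ℚ_[l]) := by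
  obtain ⟨z, hz, -⟩ := hensels_lemma (p := l) (R := ℤ_[l])
    (F := Polynomial.X ^ 2 - Polynomial.C (1 - m)) (a := 1) (by
      simpa [one_add_one_eq_two] using h)
  have hz' : z ^ 2 - (1 - m) = 0 := by simpa using hz
  refine ⟨z, ?_⟩
  rw [← PadicInt.coe_mul, ← sq, sub_eq_zero.1 hz', PadicInt.coe_sub, PadicInt.coe_one]

/-- The trivial class comes from the point at infinity, which the affine equations omit. A nearby
l-adic point with z₁ = 1/(4l) is used instead. -/
theorem everywhereLocallySoluble_one (p : ℕ) : EverywhereLocallySoluble p 1 1 := by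
  constructor
  · refine ⟨√(24 * p), √(9 * p), 0, ?_, ?_⟩
    · have h1 := Real.sq_sqrt (by positivity : (0 : ℝ) ≤ 24 * p)
      have h2 := Real.sq_sqrt (by positivity : (0 : ℝ) ≤ 9 * p)
      rw [h1, h2]
      push_cast
      ring
    · rw [Real.sq_sqrt (by positivity)]
      push_cast
      ring
  · intro l _
    have hl0 : (l : ℚ_[l]) ≠ 0 := by exact_mod_cast (Fact.out : l.Prime).ne_zero
    have key : ∀ n : ℕ, IsSquare (1 - n * (4 * l : ℚ_[l]) ^ 2) := by
      intro n
      have h4 : (0 : ℝ) < ‖(2 : ℤ_[l])‖ := norm_pos_iff.2 two_ne_zero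
      have h41 : ‖(2 : ℤ_[l])‖ ≤ 1 := PadicInt.norm_le_one _
      have hl1 : ‖(l : ℤ_[l])‖ < 1 := by
        rw [PadicInt.norm_def]
        exact Padic.norm_p_lt_one
      have hlt : ‖(n : ℤ_[l]) * (2 * 2 * l) ^ 2‖ < ‖(2 : ℤ_[l])‖ ^ 2 := by
        have e : (n : ℤ_[l]) * (2 * 2 * l) ^ 2 = 2 ^ 2 * (n * 2 ^ 2 * l * l) := by ring
        rw [e, norm_mul, norm_pow]
        refine mul_lt_of_lt_one_right (by positivity) ?_
        rw [norm_mul]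
        exact mul_lt_one_of_nonneg_of_lt_one_right (PadicInt.norm_le_one _) (norm_nonneg _) hl1
      have h5 := isSquare_one_sub_of_norm_lt hlt
      have e2 : ((2 : ℤ_[l]) : ℚ_[l]) = 2 := rfl
      push_cast [e2] at h5
      convert! h5 using 3
      norm_num
    obtain ⟨r, hr⟩ := key (15 * p)
    obtain ⟨t, ht⟩ := key (24 * p)
    have h40 : (4 * l : ℚ_[l]) ≠ 0 := mul_ne_zero (by norm_num) hl0
    refine ⟨1 / (4 * l), r / (4 * l), t / (4 * l), ?_, ?_⟩
    · push_cast at hr ⊢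
      field_simp
      linear_combination hr
    · push_cast at ht ⊢
      field_simp
      linear_combination ht

theorem EverywhereLocallySoluble.of_forall {p : ℕ} {b₁ b₂ : ℚˣ} 
    (h : ∀ (K : Type) [Field K] [CharZero K], HasPoint K p b₁ b₂) :
    EverywhereLocallySoluble p b₁ b₂ :=
  ⟨h ℝ, fun l _ => h ℚ_[l]⟩

/-- The witnesses are rational and lie over X = 0, 15p, 24p, where X = b₁z₁². -/
theorem hasPoint_of_two_torsion {K : Type} [Field K] [CharZero K] {p : ℕ} {β₁ β₂ : ℚˣ}
    (h : ((β₁ : ℚ) = 10 ∧ (β₂ : ℚ) = -15 * p) ∨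
    ((β₁ : ℚ) = 15 * p ∧ (β₂ : ℚ) = -15) ∨ ((β₁ : ℚ) = 6 * p ∧ (β₂ : ℚ) = p)) :
    HasPoint K p β₁ β₂ := by
  rcases h with ⟨h1, h2⟩ | ⟨h1, h2⟩ | ⟨h1, h2⟩
  · refine ⟨0, 1, 2 / 5, ?_, ?_⟩ <;> rw [h1, h2] <;> push_cast <;> ring
  · refine ⟨1, 0, 1 / 5, ?_, ?_⟩ <;> rw [h1, h2] <;> push_cast <;> ring
  · refine ⟨2, 3, 0, ?_, ?_⟩ <;> rw [h1, h2] <;> push_cast <;> ring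

/-- The four classes coming from the `2`-torsion. -/
def torsionClasses (p : ℕ) : Set (SquareClass × SquareClass) :=
  {(ratClass 1, ratClass 1), (ratClass 10, ratClass (-15 * p)),
    (ratClass (15 * p), ratClass (-15)), (ratClass (6 * p), ratClass p)}

/-! ### The Selmer group and its order. -/

section Selmer

variable {p : ℕ} (hp : p.Prime) (hmod : p % 120 = 53 ∨ p % 120 = 77)
include hp

theorem exists_mul_sq_eq_sUnit {u : ℚˣ} (hu : (u : SquareClass) ∈ QS2 (badPrimes p)) :
    ∃ (s a b c d : Bool) (w : ℚˣ),
      ((u * w ^ 2 : ℚˣ) : ℚ) = sUnit p s.toNat a.toNat b.toNat c.toNat d.toNat := by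
  obtain ⟨v, hv, hvu⟩ := Subgroup.mem_map.1 hu
  obtain ⟨s, a, b, c, d, w, h⟩ := exists_sUnit_of_mem hp hv
  obtain ⟨r, hr⟩ := mk_eq_mk_iff.1 (show (u : SquareClass) = v from hvu.symm)
  exact ⟨s, a, b, c, d, r * w, by rw [← h, hr, mul_pow, mul_assoc]⟩

theorem mk_mem_QS2 (q : ℚ) (s a b c d : ℕ) (h : q = sUnit p s a b c d) :
    ratClass q ∈ QS2 (badPrimes p) := by
  have hp0 : (p : ℚ) ≠ 0 := by exact_mod_cast hp.ne_zero
  have hq : q ≠ 0 := by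
    rw [h, sUnit]
    positivity
  rw [← mk_eq_ratClass (u := Units.mk0 q hq) (Units.val_mk0 hq)]
  exact Subgroup.mem_map_of_mem _ (mem_evenOutside_of_eq_sUnit hp (by rw [Units.val_mk0, h]))

theorem torsionClasses_subset : torsionClasses p ⊆ selmerTwo p := by
  have hp0 : (p : ℚ) ≠ 0 := by exact_mod_cast hp.ne_zero
  rintro c (rfl | rfl | rfl | rfl)
  · refine ⟨mk_mem_QS2 hp 1 0 0 0 0 0 (by simp [sUnit]), mk_mem_QS2 hp 1 0 0 0 0 0 (by simp [sUnit]),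
      1, 1, mk_eq_ratClass rfl, mk_eq_ratClass rfl, everywhereLocallySoluble_one p⟩
  · exact ⟨mk_mem_QS2 hp 10 0 1 0 1 0 (by norm_num [sUnit]),
      mk_mem_QS2 hp (-15 * p) 1 0 1 1 1 (by norm_num [sUnit]),
      Units.mk0 10 (by norm_num), Units.mk0 (-15 * p) (by simp [hp0]), mk_eq_ratClass rfl,
      mk_eq_ratClass rfl, .of_forall fun K => hasPoint_of_two_torsion (.inl ⟨rfl, rfl⟩)⟩
  · exact ⟨mk_mem_QS2 hp (15 * p) 0 0 1 1 1 (by norm_num [sUnit]),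
      mk_mem_QS2 hp (-15) 1 0 1 1 0 (by norm_num [sUnit]),
      Units.mk0 (15 * p) (by simp [hp0]), Units.mk0 (-15) (by norm_num), mk_eq_ratClass rfl,
      mk_eq_ratClass rfl, .of_forall fun K => hasPoint_of_two_torsion (.inr (.inl ⟨rfl, rfl⟩))⟩
  · exact ⟨mk_mem_QS2 hp (6 * p) 0 1 1 0 1 (by norm_num [sUnit]),
      mk_mem_QS2 hp p 0 0 0 0 1 (by norm_num [sUnit]),
      Units.mk0 (6 * p) (by simp [hp0]), Units.mk0 p hp0, mk_eq_ratClass rfl,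
      mk_eq_ratClass rfl, .of_forall fun K => hasPoint_of_two_torsion (.inr (.inr ⟨rfl, rfl⟩))⟩

include hmod

theorem selmerTwo_subset : selmerTwo p ⊆ torsionClasses p := by
  have : Fact p.Prime := ⟨hp⟩
  rintro ⟨c₁, c₂⟩ ⟨h₁, h₂, β₁, β₂, rfl, rfl, h⟩
  obtain ⟨s₁, a₁, b₁, c₁, d₁, w₁, e₁⟩ := exists_mul_sq_eq_sUnit hp h₁
  obtain ⟨s₂, a₂, b₂, c₂, d₂, w₂, e₂⟩ := exists_mul_sq_eq_sUnit hp h₂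
  have m₁ : (β₁ : SquareClass) = (β₁ * w₁ ^ 2 : ℚˣ) := mk_eq_mk_iff.2 ⟨w₁, rfl⟩
  have m₂ : (β₂ : SquareClass) = (β₂ * w₂ ^ 2 : ℚˣ) := mk_eq_mk_iff.2 ⟨w₂, rfl⟩
  simp only [m₁, m₂]
  rcases eq_of_everywhereLocallySoluble hmod e₁ e₂ (h.mul_sq w₁ w₂) with h | h | h | h
  · exact .inl (Prod.ext (mk_eq_ratClass h.1) (mk_eq_ratClass h.2))
  · exact .inr (.inl (Prod.ext (mk_eq_ratClass h.1) (mk_eq_ratClass h.2)))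
  · exact .inr (.inr (.inl (Prod.ext (mk_eq_ratClass h.1) (mk_eq_ratClass h.2))))
  · exact .inr (.inr (.inr (Prod.ext (mk_eq_ratClass h.1) (mk_eq_ratClass h.2))))

theorem selmerTwo_eq : selmerTwo p = torsionClasses p :=
  (selmerTwo_subset hp hmod).antisymm (torsionClasses_subset hp)

theorem card_torsionClasses : Nat.card (torsionClasses p) = 4 := by
  have hp0 : (p : ℚ) ≠ 0 := by exact_mod_cast hp.ne_zero
  -- The first coordinates alone separate the four classes: each product of two of them has odd
  -- valuation at 3 or at 5.
  have key3 : ∀ {q r : ℚ} (a b c d : ℕ), q ≠ 0 → r ≠ 0 → q * r = sUnit p 0 a b c d → b % 2 = 1 →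
      ratClass q ≠ ratClass r := by
    intro q r a b c d hq hr h hb hqr
    have h1 := isSquare_of_ratClass_eq hq hr hqr
    rw [h] at h1
    have h2 := (even_of_isSquare_at_three hmod (h1.map (Rat.castHom ℚ_[3]))).2
    rw [Nat.even_iff] at h2
    omega
  have key5 : ∀ {q r : ℚ} (a b c d : ℕ), q ≠ 0 → r ≠ 0 → q * r = sUnit p 0 a b c d → c % 2 = 1 →
      ratClass q ≠ ratClass r := by
    intro q r a b c d hq hr h hb hqr
    have h1 := isSquare_of_ratClass_eq hq hr hqr
    rw [h] at h1
    have h2 := (even_of_isSquare_at_five hmod (h1.map (Rat.castHom ℚ_[5]))).2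
    rw [Nat.even_iff] at h2
    omega
  have n10 : (10 : ℚ) ≠ 0 := by norm_num
  have n15 : (15 * p : ℚ) ≠ 0 := mul_ne_zero (by norm_num) hp0
  have n6 : (6 * p : ℚ) ≠ 0 := mul_ne_zero (by norm_num) hp0
  have k1 := key5 1 0 1 0 one_ne_zero n10 (by norm_num [sUnit]) rfl
  have k2 := key5 0 1 1 1 one_ne_zero n15 (by norm_num [sUnit]) rfl
  have k3 := key3 1 1 0 1 one_ne_zero n6 (by norm_num [sUnit]) rfl
  have k4 := key3 1 1 2 1 n10 n15 (by norm_num [sUnit]; ring) rfl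
  have k5 := key5 2 1 1 1 n10 n6 (by norm_num [sUnit]; ring) rfl
  have k6 := key5 1 2 1 2 n15 n6 (by norm_num [sUnit]; ring) rfl
  rw [Nat.card_coe_set_eq, torsionClasses, Set.ncard_insert_of_notMem (by simp [k1, k2, k3]),
    Set.ncard_insert_of_notMem (by simp [k4, k5]), Set.ncard_insert_of_notMem (by simp [k6]),
    Set.ncard_singleton]

end Selmer

/-! ### Infinite descent by halving. -/

section Descent

/-- In a commutative group with a height function for which `2 P` has height at least
`4 h(P) - C`, the elements of a set in which every element is twice another one are torsion. -/
theorem exists_smul_eq_zero_of_halving {G : Type*} [AddCommGroup G] {h : G → ℝ} [Northcott h]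
    {C : ℝ} (hC : ∀ P, 4 * h P - C ≤ h ((2 : ℕ) • P)) {D : Set G}
    (hD : ∀ P ∈ D, ∃ Q ∈ D, P = (2 : ℕ) • Q) {P : G} (hP : P ∈ D) :
    ∃ n : ℤ, n ≠ 0 ∧ n • P = 0 := by
  -- With B ≥ C and B ≥ 0, h(2R) ≤ B gives h(R) ≤ (B + C)/4 ≤ B, so halving preserves the finite set
  -- of height at most B.
  set B : ℝ := max (h P) (max C 0) with hB
  have hCB : C ≤ B := (le_max_left _ _).trans (le_max_right _ _)
  have hB0 : 0 ≤ B := (le_max_right _ _).trans (le_max_right _ _)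
  let S : Set G := {Q | Q ∈ D ∧ h Q ≤ B}
  have hS : S.Finite := (Northcott.finite_le (h := h) B).subset fun Q hQ => hQ.2
  have step : ∀ Q : S, ∃ R : S, (Q : G) = (2 : ℕ) • (R : G) := by
    rintro ⟨Q, hQD, hQB⟩
    obtain ⟨R, hRD, hR⟩ := hD Q hQD
    refine ⟨⟨R, hRD, ?_⟩, hR⟩
    have h1 := hC R
    rw [← hR] at h1
    linarith
  choose g hg using step
  have hginj : Function.Injective g := by
    intro Q R hQR
    apply Subtype.ext
    rw [hg Q, hg R, hQR]
  have : Finite S := hS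
  have hiter : ∀ (n : ℕ) (Q : S), (Q : G) = (2 ^ n : ℕ) • ((g^[n] Q : S) : G) := by
    intro n
    induction n with
    | zero => intro Q; simp
    | succ n ih =>
      intro Q
      rw [Function.iterate_succ_apply', pow_succ, mul_smul, ← hg, ← ih]
  have hPS : h P ≤ B := le_max_left _ _
  -- Doubling recovers Q from g Q, so g is an injective self-map of a finite set. P is thus
  -- periodic, and P = 2ⁿP.
  obtain ⟨n, hn, hfix⟩ := hginj.mem_periodicPts ⟨P, hP, hPS⟩
  have h1 := hiter n ⟨P, hP, hPS⟩
  rw [hfix.eq] at h1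
  refine ⟨2 ^ n - 1, ?_, ?_⟩
  · have : (2 : ℤ) ≤ 2 ^ n := le_self_pow₀ (by norm_num) hn.ne'
    omega
  · rw [sub_smul, one_smul, sub_eq_zero]
    have h2 : ((2 : ℤ) ^ n) • P = (2 ^ n : ℕ) • P := by
      rw [← natCast_zsmul]
      push_cast
      rfl
    rw [h2]
    exact h1.symm

end Descent

open WeierstrassCurve WeierstrassCurve.Affine

/-! ### Duplication, chords and halving on the curve. -/

section Points

variable {p : ℕ}

theorem curve_nonsingular (hp : p ≠ 0) {x y : ℚ}
    (h : y ^ 2 = (x + 6 * (p : ℚ)) * (x - 9 * (p : ℚ)) * (x - 18 * (p : ℚ))) :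
    (curve p).toAffine.Nonsingular x y := by
  have := curve_isElliptic p hp
  exact (equation_iff_nonsingular (W := (curve p).toAffine)).1 ((curve_equation_iff p x y).2 h)

theorem curve_negY (x y : ℚ) : (curve p).toAffine.negY x y = -y := by
  simp [negY, curve]

theorem some_eq_some {x y x' y' : ℚ} {h : (curve p).toAffine.Nonsingular x y}
    {h' : (curve p).toAffine.Nonsingular x' y'} (hx : x = x') (hy : y = y') :
    Point.some x y h = Point.some x' y' h' := by
  subst hx hy
  rfl

theorem two_nsmul_some_eq_zero_iff {x y : ℚ} (h : (curve p).toAffine.Nonsingular x y) :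
    (2 : ℕ) • Point.some x y h = 0 ↔ y = 0 := by
  rw [two_nsmul, add_eq_zero_iff_eq_neg, Point.neg_some, Point.some.injEq, curve_negY]
  constructor
  · rintro ⟨-, h⟩
    linarith
  · rintro rfl
    simp

theorem two_nsmul_some {x y : ℚ} (h : (curve p).toAffine.Nonsingular x y) (hy : y ≠ 0) :
    ∃ (y' : ℚ) (h' : (curve p).toAffine.Nonsingular
      (((3 * x ^ 2 - 42 * p * x) / (2 * y)) ^ 2 + 21 * p - 2 * x) y'),
      (2 : ℕ) • Point.some x y h = Point.some _ y' h' := by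
  have hne : y ≠ (curve p).toAffine.negY x y := by
    rw [curve_negY]
    intro h1
    exact hy (by linarith)
  rw [two_nsmul, Point.add_self_of_Y_ne hne]
  have hx : (curve p).toAffine.addX x x ((curve p).toAffine.slope x x y y) =
      ((3 * x ^ 2 - 42 * p * x) / (2 * y)) ^ 2 + 21 * p - 2 * x := by
    rw [slope_of_Y_ne rfl hne, curve_negY, addX]
    simp only [curve]
    ring
  generalize_proofs hn
  exact ⟨_, hx ▸ hn, some_eq_some hx rfl⟩

theorem some_add_some {x₁ y₁ x₂ y₂ : ℚ} (h₁ : (curve p).toAffine.Nonsingular x₁ y₁)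
    (h₂ : (curve p).toAffine.Nonsingular x₂ y₂) (hx : x₁ ≠ x₂) :
    ∃ (y' : ℚ) (h' : (curve p).toAffine.Nonsingular
      (((y₁ - y₂) / (x₁ - x₂)) ^ 2 + 21 * p - x₁ - x₂) y'),
      Point.some x₁ y₁ h₁ + Point.some x₂ y₂ h₂ = Point.some _ y' h' := by
  rw [Point.add_of_X_ne hx]
  have hx : (curve p).toAffine.addX x₁ x₂ ((curve p).toAffine.slope x₁ x₂ y₁ y₂) =
      ((y₁ - y₂) / (x₁ - x₂)) ^ 2 + 21 * p - x₁ - x₂ := by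
    rw [slope_of_X_ne hx, addX]
    simp only [curve]
    ring
  generalize_proofs hn
  exact ⟨_, hx ▸ hn, some_eq_some hx rfl⟩

theorem equation_of_nonsingular {x y : ℚ} (h : (curve p).toAffine.Nonsingular x y) :
    y ^ 2 = (x + 6 * (p : ℚ)) * (x - 9 * (p : ℚ)) * (x - 18 * (p : ℚ)) :=
  (curve_equation_iff p x y).1 h.1

/-- A point whose `x - eᵢ` are squares is divisible by two. -/
theorem exists_eq_two_nsmul (hp : p ≠ 0) {x y : ℚ} (h : (curve p).toAffine.Nonsingular x y)
    (h₁ : IsSquare (x + 6 * (p : ℚ))) (h₂ : IsSquare (x - 9 * (p : ℚ)))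
    (n₁ : x + 6 * (p : ℚ) ≠ 0) (n₂ : x - 9 * (p : ℚ) ≠ 0) :
    ∃ Q : (curve p).toAffine.Point, Point.some x y h = (2 : ℕ) • Q := by
  have hp0 : (p : ℚ) ≠ 0 := by exact_mod_cast hp
  obtain ⟨r₁, hr₁⟩ := h₁
  obtain ⟨r₂, hr₂⟩ := h₂
  have hr₁0 : r₁ ≠ 0 := by
    rintro rfl
    exact n₁ (by rw [hr₁, mul_zero])
  have hr₂0 : r₂ ≠ 0 := by
    rintro rfl
    exact n₂ (by rw [hr₂, mul_zero])
  have heq := equation_of_nonsingular h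
  obtain ⟨r₃, hr₃⟩ : ∃ r₃, x - 18 * (p : ℚ) = r₃ * r₃ := by
    refine ⟨y / (r₁ * r₂), ?_⟩
    rw [hr₁, hr₂] at heq
    field_simp
    linear_combination -heq
  have d₁₂ : r₁ + r₂ ≠ 0 := by
    intro h0
    have : 15 * (p : ℚ) = 0 := by linear_combination hr₁ - hr₂ + (r₁ - r₂) * h0
    simp [hp0] at this
  have d₁₃ : r₁ + r₃ ≠ 0 := by
    intro h0
    have : 24 * (p : ℚ) = 0 := by linear_combination hr₁ - hr₃ + (r₁ - r₃) * h0
    simp [hp0] at this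
  have d₂₃ : r₂ + r₃ ≠ 0 := by
    intro h0
    have : 9 * (p : ℚ) = 0 := by linear_combination hr₂ - hr₃ + (r₂ - r₃) * h0
    simp [hp0] at this
  -- The classical half-point: X - eᵢ = (rᵢ + rⱼ)(rᵢ + rₖ), where x - eᵢ = rᵢ². The tangent slope
  -- there is r₁ + r₂ + r₃.
  set X := x + r₁ * r₂ + r₁ * r₃ + r₂ * r₃ with hX
  set Y := (r₁ + r₂) * (r₁ + r₃) * (r₂ + r₃) with hY
  have hY0 : Y ≠ 0 := mul_ne_zero (mul_ne_zero d₁₂ d₁₃) d₂₃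
  have e₁ : X + 6 * p = (r₁ + r₂) * (r₁ + r₃) := by linear_combination hr₁
  have e₂ : X - 9 * p = (r₁ + r₂) * (r₂ + r₃) := by linear_combination hr₂
  have e₃ : X - 18 * p = (r₁ + r₃) * (r₂ + r₃) := by linear_combination hr₃
  have hQ : Y ^ 2 = (X + 6 * (p : ℚ)) * (X - 9 * (p : ℚ)) * (X - 18 * (p : ℚ)) := by
    rw [e₁, e₂, e₃]
    ring
  have hslope : (3 * X ^ 2 - 42 * p * X) / (2 * Y) = r₁ + r₂ + r₃ := by
    rw [div_eq_iff (mul_ne_zero two_ne_zero hY0)]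
    have : 3 * X ^ 2 - 42 * p * X = (X + 6 * p) * (X - 9 * p) + (X + 6 * p) * (X - 18 * p) +
        (X - 9 * p) * (X - 18 * p) := by ring
    rw [this, e₁, e₂, e₃]
    ring
  obtain ⟨y', h', hdbl⟩ := two_nsmul_some (curve_nonsingular hp hQ) hY0
  have hx : ((3 * X ^ 2 - 42 * p * X) / (2 * Y)) ^ 2 + 21 * p - 2 * X = x := by
    rw [hslope]
    linear_combination -hr₁ - hr₂ - hr₃
  -- The x-coordinate fixes the double only up to sign; in the second case -Q is the half.
  have hy : y = y' ∨ y = -y' := by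
    have h1 := equation_of_nonsingular h'
    rw [hx, ← heq] at h1
    exact sq_eq_sq_iff_eq_or_eq_neg.1 h1.symm
  rcases hy with hy | hy
  · exact ⟨_, (some_eq_some hx.symm hy).trans hdbl.symm⟩
  · refine ⟨-Point.some X Y (curve_nonsingular hp hQ), ?_⟩
    rw [two_nsmul, ← neg_add, ← two_nsmul, hdbl, Point.neg_some]
    exact some_eq_some hx.symm (by rw [curve_negY, hy])

end Points

section TwoTorsion

variable {p : ℕ} (hp : p ≠ 0)
include hp

theorem nonsingular_root₁ : (curve p).toAffine.Nonsingular (-6 * p) 0 :=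
  curve_nonsingular hp (by ring)

theorem nonsingular_root₂ : (curve p).toAffine.Nonsingular (9 * p) 0 :=
  curve_nonsingular hp (by ring)

theorem nonsingular_root₃ : (curve p).toAffine.Nonsingular (18 * p) 0 :=
  curve_nonsingular hp (by ring)

theorem card_two_torsion :
    Nat.card {P : (curve p).toAffine.Point // (2 : ℕ) • P = 0} = 4 := by
  have hp0 : (p : ℚ) ≠ 0 := by exact_mod_cast hp
  have key : {P : (curve p).toAffine.Point | (2 : ℕ) • P = 0} =
      {0, Point.some _ _ (nonsingular_root₁ hp), Point.some _ _ (nonsingular_root₂ hp),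
        Point.some _ _ (nonsingular_root₃ hp)} := by
    ext P
    simp only [Set.mem_ofPred_eq, Set.mem_insert_iff, Set.mem_singleton_iff]
    constructor
    · intro h
      match P, h with
      | 0, _ => exact .inl rfl
      | .some x y hP, h =>
        right
        have hy := (two_nsmul_some_eq_zero_iff hP).1 h
        have heq := equation_of_nonsingular hP
        rw [hy, zero_pow two_ne_zero, eq_comm, mul_eq_zero, mul_eq_zero] at heq
        rcases heq with (h1 | h1) | h1
        · exact .inl (some_eq_some (by linarith) hy)
        · exact .inr (.inl (some_eq_some (by linarith) hy))
        · exact .inr (.inr (some_eq_some (by linarith) hy))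
    · rintro (rfl | rfl | rfl | rfl)
      · simp
      all_goals rw [two_nsmul_some_eq_zero_iff]
  have c1 : (-6 * p : ℚ) ≠ 9 * p := fun h => hp0 (by linarith)
  have c2 : (-6 * p : ℚ) ≠ 18 * p := fun h => hp0 (by linarith)
  have c3 : (9 * p : ℚ) ≠ 18 * p := fun h => hp0 (by linarith)
  change Nat.card ({P : (curve p).toAffine.Point | (2 : ℕ) • P = 0} : Set _) = 4
  rw [key, Nat.card_coe_set_eq, Set.ncard_insert_of_notMem, Set.ncard_insert_of_notMem,
    Set.ncard_insert_of_notMem, Set.ncard_singleton]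
  · rw [Set.mem_singleton_iff, Point.some.injEq]
    exact fun h => c3 h.1
  · rw [Set.mem_insert_iff, Set.mem_singleton_iff, Point.some.injEq, Point.some.injEq]
    exact fun h => h.elim (fun h => c1 h.1) (fun h => c2 h.1)
  · rw [Set.mem_insert_iff, Set.mem_insert_iff, Set.mem_singleton_iff]
    rintro (h | h | h) <;> exact absurd h.symm (Point.some_ne_zero _)

end TwoTorsion

theorem padicValRat_trichotomy {l : ℕ} [Fact l.Prime] {a b d : ℚ} (ha : a ≠ 0) (hb : b ≠ 0)
    (hd0 : d ≠ 0) (h : a = b + d) (hd : padicValRat l d = 0) :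
    (padicValRat l b < 0 → padicValRat l a = padicValRat l b) ∧
    (0 < padicValRat l b → padicValRat l a = 0) ∧
    (padicValRat l b = 0 → 0 ≤ padicValRat l a) := by
  subst h
  refine ⟨fun h => ?_, fun h => ?_, fun h => ?_⟩
  · exact padicValRat.add_eq_of_lt ha hb hd0 (by rw [hd]; exact h)
  · rw [add_comm] at ha ⊢
    rw [padicValRat.add_eq_of_lt ha hd0 hb (by rw [hd]; exact h), hd]
  · have := padicValRat.min_le_padicValRat_add (p := l) ha
    rw [h, hd, min_self] at this
    exact this

/-! ### Kummer classes of rational points, and divisibility by 2. -/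

section Descent

variable {p : ℕ} (hp : p.Prime)
include hp

/-- The Kummer image of a rational point is unramified outside the bad primes. -/
theorem mem_evenOutside_of_point {y : ℚ} {u₁ u₂ : ℚˣ} {u₃ : ℚ} (hu₃ : u₃ ≠ 0)
    (heq : y ^ 2 = u₁ * u₂ * u₃) (h₁₂ : (u₁ : ℚ) - u₂ = 15 * p) (h₁₃ : (u₁ : ℚ) - u₃ = 24 * p) :
    u₁ ∈ evenOutside (badPrimes p) ∧ u₂ ∈ evenOutside (badPrimes p) := by
  have hp0 : (p : ℚ) ≠ 0 := by exact_mod_cast hp.ne_zero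
  have n₁ := u₁.ne_zero
  have n₂ := u₂.ne_zero
  have hy : y ≠ 0 := by
    rintro rfl
    rw [zero_pow two_ne_zero] at heq
    exact mul_ne_zero (mul_ne_zero n₁ n₂) hu₃ heq.symm
  suffices key : ∀ l : ℕ, l.Prime → l ∉ badPrimes p →
      Even (padicValRat l (u₁ : ℚ)) ∧ Even (padicValRat l (u₂ : ℚ)) from
    ⟨fun l hl hS => (key l hl hS).1, fun l hl hS => (key l hl hS).2⟩
  intro l hl hlS
  have : Fact l.Prime := ⟨hl⟩
  have hv : ∀ {d : ℚ} (s a b c e : ℕ), d = sUnit p s a b c e → d ≠ 0 ∧ padicValRat l d = 0 := by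
    rintro d s a b c e rfl
    refine ⟨?_, padicValRat_sUnit hp hl hlS s a b c e⟩
    rw [sUnit]
    positivity
  have v15 := hv 0 0 1 1 1 (show (15 * p : ℚ) = _ by norm_num [sUnit])
  have v15' := hv 1 0 1 1 1 (show (-(15 * p) : ℚ) = _ by norm_num [sUnit])
  have v24 := hv 0 3 1 0 1 (show (24 * p : ℚ) = _ by norm_num [sUnit])
  have v24' := hv 1 3 1 0 1 (show (-(24 * p) : ℚ) = _ by norm_num [sUnit])
  have v9 := hv 0 0 2 0 1 (show (9 * p : ℚ) = _ by norm_num [sUnit])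
  have v9' := hv 1 0 2 0 1 (show (-(9 * p) : ℚ) = _ by norm_num [sUnit])
  have t12 := padicValRat_trichotomy (l := l) n₁ n₂ v15.1 (by linarith) v15.2
  have t21 := padicValRat_trichotomy (l := l) n₂ n₁ v15'.1 (by linarith) v15'.2
  have t13 := padicValRat_trichotomy (l := l) n₁ hu₃ v24.1 (by linarith) v24.2
  have t31 := padicValRat_trichotomy (l := l) hu₃ n₁ v24'.1 (by linarith) v24'.2
  have t23 := padicValRat_trichotomy (l := l) n₂ hu₃ v9.1 (by linarith) v9.2
  have t32 := padicValRat_trichotomy (l := l) hu₃ n₂ v9'.1 (by linarith) v9'.2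
  have hval := congrArg (padicValRat l) heq
  rw [padicValRat.pow, padicValRat.mul (mul_ne_zero n₁ n₂) hu₃, padicValRat.mul n₁ n₂] at hval
  rw [Int.even_iff, Int.even_iff]
  push_cast at hval
  -- The differences of the uᵢ are l-units. Either all three valuations equal one negative v, and 3v
  -- is even, or none is negative and at most one is positive, hence equal to 2·ord(y).
  omega

omit hp in
theorem hasPoint_of_point {K : Type} [Field K] [CharZero K] {y : ℚ} {u₁ u₂ : ℚˣ} {u₃ : ℚ}
    (heq : y ^ 2 = u₁ * u₂ * u₃) (h₁₂ : (u₁ : ℚ) - u₂ = 15 * p) (h₁₃ : (u₁ : ℚ) - u₃ = 24 * p) :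
    HasPoint K p u₁ u₂ := by
  have e : ((u₁ : ℚ)) * u₂ * (y / (u₁ * u₂)) ^ 2 = u₃ := by
    have n₁ := u₁.ne_zero
    have n₂ := u₂.ne_zero
    field_simp
    linear_combination heq
  refine ⟨1, 1, ((y / (u₁ * u₂) : ℚ) : K), ?_, ?_⟩
  · rw [one_pow, mul_one, mul_one]
    exact_mod_cast congrArg (fun q : ℚ => (q : K)) h₁₂
  · rw [one_pow, mul_one]
    have e' := congrArg (fun q : ℚ => (q : K)) e
    have h' := congrArg (fun q : ℚ => (q : K)) h₁₃
    push_cast at e' h' ⊢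
    rw [e', h']

variable (hmod : p % 120 = 53 ∨ p % 120 = 77)
include hmod

theorem isTorsionClass_of_point {y u₁ u₂ u₃ : ℚ} (n₁ : u₁ ≠ 0) (n₂ : u₂ ≠ 0) (n₃ : u₃ ≠ 0)
    (heq : y ^ 2 = u₁ * u₂ * u₃) (h₁₂ : u₁ - u₂ = 15 * p) (h₁₃ : u₁ - u₃ = 24 * p) :
    IsTorsionClass p u₁ u₂ := by
  have hp0 : (p : ℚ) ≠ 0 := by exact_mod_cast hp.ne_zero
  obtain ⟨v₁, rfl⟩ : ∃ v : ℚˣ, (v : ℚ) = u₁ := ⟨Units.mk0 u₁ n₁, rfl⟩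
  obtain ⟨v₂, rfl⟩ : ∃ v : ℚˣ, (v : ℚ) = u₂ := ⟨Units.mk0 u₂ n₂, rfl⟩
  have hS := mem_evenOutside_of_point hp n₃ heq h₁₂ h₁₃
  have hmem : ((v₁ : SquareClass), (v₂ : SquareClass)) ∈ selmerTwo p :=
    ⟨Subgroup.mem_map_of_mem _ hS.1, Subgroup.mem_map_of_mem _ hS.2, v₁, v₂, rfl, rfl,
      .of_forall fun K _ _ => hasPoint_of_point heq h₁₂ h₁₃⟩
  rw [selmerTwo_eq hp hmod, mk_eq_ratClass (u := v₁) rfl, mk_eq_ratClass (u := v₂) rfl] at hmem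
  rcases hmem with h | h | h | h <;> obtain ⟨h1, h2⟩ := Prod.ext_iff.1 h
  · left
    have s1 := isSquare_of_ratClass_eq n₁ one_ne_zero h1
    have s2 := isSquare_of_ratClass_eq n₂ one_ne_zero h2
    rw [mul_one] at s1 s2
    exact ⟨s1, s2⟩
  · exact .inr (.inl ⟨isSquare_of_ratClass_eq n₁ (by norm_num) h1,
      isSquare_of_ratClass_eq n₂ (by simp [hp0]) h2⟩)
  · exact .inr (.inr (.inl ⟨isSquare_of_ratClass_eq n₁ (by simp [hp0]) h1,
      isSquare_of_ratClass_eq n₂ (by norm_num) h2⟩))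
  · exact .inr (.inr (.inr ⟨isSquare_of_ratClass_eq n₁ (by simp [hp0]) h1,
      isSquare_of_ratClass_eq n₂ hp0 h2⟩))

/-- Twice a rational point is four times a rational point. -/
theorem exists_two_nsmul_eq (P : (curve p).toAffine.Point) :
    ∃ Q : (curve p).toAffine.Point, (2 : ℕ) • P = (2 : ℕ) • ((2 : ℕ) • Q) := by
  have hp0 : (p : ℚ) ≠ 0 := by exact_mod_cast hp.ne_zero
  by_cases h2P : (2 : ℕ) • P = 0
  · exact ⟨0, by rw [h2P]; simp⟩
  match P, h2P with
  | 0, h => exact absurd (by simp) h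
  | .some x y h, h2P =>
    have hy : y ≠ 0 := fun h0 => h2P ((two_nsmul_some_eq_zero_iff h).2 h0)
    have heq := equation_of_nonsingular h
    have hprod : (x + 6 * (p : ℚ)) * (x - 9 * (p : ℚ)) * (x - 18 * (p : ℚ)) ≠ 0 := by
      rw [← heq]
      exact pow_ne_zero 2 hy
    have n₁ : x + 6 * (p : ℚ) ≠ 0 := left_ne_zero_of_mul (left_ne_zero_of_mul hprod)
    have n₂ : x - 9 * (p : ℚ) ≠ 0 := right_ne_zero_of_mul (left_ne_zero_of_mul hprod)
    have n₃ : x - 18 * (p : ℚ) ≠ 0 := right_ne_zero_of_mul hprod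
    -- For T = (e, 0), the constants 27 = 21 + 6 and 12 = 21 - 9 come from shifting x(P + T) by 6p
    -- and -9p. A half of P + T suffices, because 2(P + T) = 2P.
    have key : ∀ {e : ℚ} (hT : (curve p).toAffine.Nonsingular e 0), x ≠ e →
        IsSquare ((y / (x - e)) ^ 2 + 27 * p - x - e) →
        IsSquare ((y / (x - e)) ^ 2 + 12 * p - x - e) →
        (y / (x - e)) ^ 2 + 27 * p - x - e ≠ 0 → (y / (x - e)) ^ 2 + 12 * p - x - e ≠ 0 →
        ∃ Q : (curve p).toAffine.Point,
          (2 : ℕ) • Point.some x y h = (2 : ℕ) • ((2 : ℕ) • Q) := by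
      intro e hT hxe s₁ s₂ m₁ m₂
      obtain ⟨y', h', hadd⟩ := some_add_some h hT hxe
      have e₁ : ((y - 0) / (x - e)) ^ 2 + 21 * p - x - e + 6 * p =
          (y / (x - e)) ^ 2 + 27 * p - x - e := by ring
      have e₂ : ((y - 0) / (x - e)) ^ 2 + 21 * p - x - e - 9 * p =
          (y / (x - e)) ^ 2 + 12 * p - x - e := by ring
      obtain ⟨Q, hQ⟩ := exists_eq_two_nsmul hp.ne_zero h' (e₁ ▸ s₁) (e₂ ▸ s₂) (e₁ ▸ m₁) (e₂ ▸ m₂)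
      refine ⟨Q, ?_⟩
      rw [← hQ, ← hadd, nsmul_add, (two_nsmul_some_eq_zero_iff hT).2 rfl, add_zero]
    rcases isTorsionClass_of_point hp hmod n₁ n₂ n₃ heq (by ring) (by ring) with
      ⟨⟨r₁, h₁⟩, ⟨r₂, h₂⟩⟩ | ⟨⟨r₁, h₁⟩, ⟨r₂, h₂⟩⟩ | ⟨⟨r₁, h₁⟩, ⟨r₂, h₂⟩⟩ | ⟨⟨r₁, h₁⟩, ⟨r₂, h₂⟩⟩
    · obtain ⟨Q, hQ⟩ := exists_eq_two_nsmul hp.ne_zero h ⟨r₁, h₁⟩ ⟨r₂, h₂⟩ n₁ n₂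
      exact ⟨Q, by rw [hQ]⟩
    all_goals
      obtain ⟨u, hu⟩ : ∃ u, u = x + 6 * (p : ℚ) := ⟨_, rfl⟩
      obtain rfl : x = u - 6 * p := by linarith
      have a₁ : u - 6 * p + 6 * p = u := by ring
      have a₂ : u - 6 * p - 9 * p = u - 15 * p := by ring
      have a₃ : u - 6 * p - 18 * p = u - 24 * p := by ring
      rw [a₁] at heq n₁ h₁
      rw [a₂] at heq n₂ h₂
      rw [a₃] at heq n₃
      clear a₁ a₂ a₃ hu hprod
      obtain ⟨v, hv⟩ : ∃ v, v = u - 15 * (p : ℚ) := ⟨_, rfl⟩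
      obtain ⟨w, hw⟩ : ∃ w, w = u - 24 * (p : ℚ) := ⟨_, rfl⟩
      rw [← hv] at heq n₂ h₂
      rw [← hw] at heq n₃
    -- T is the torsion point with the class of P, so P + T has trivial class. The product of the
    -- shifted X-coordinates of P and P + T is (e₁ - e₂)(e₁ - e₃) = 15p·24p = 360p²; the other two
    -- cases are analogous.
    · have hD : u - 6 * p - (-6 * p) = u := by ring
      have hA : (y / (u - 6 * p - (-6 * p))) ^ 2 + 27 * p - (u - 6 * p) - (-6 * p) = 360 * p ^ 2 / u := by
        rw [hD, div_pow, heq]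
        field_simp
        rw [hv, hw]
        ring
      have hB : (y / (u - 6 * p - (-6 * p))) ^ 2 + 12 * p - (u - 6 * p) - (-6 * p) = -15 * p * w / u := by
        rw [hD, div_pow, heq]
        field_simp
        rw [hv, hw]
        ring
      have sA : 360 * p ^ 2 / u = 6 * p * r₁ / u * (6 * p * r₁ / u) := by
        rw [show 6 * p * r₁ / u * (6 * p * r₁ / u) = 36 * p ^ 2 * (r₁ * r₁) / u ^ 2 by ring, ← h₁]
        field_simp
        norm_num
      have sB : -15 * p * w / u = r₂ * y / (u * v) * (r₂ * y / (u * v)) := by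
        rw [show r₂ * y / (u * v) * (r₂ * y / (u * v)) = r₂ * r₂ * y ^ 2 / (u ^ 2 * v ^ 2) by ring, ← h₂, heq]
        field_simp
      refine key (nonsingular_root₁ hp.ne_zero) (by rw [← sub_ne_zero, hD]; exact n₁)
        (hA ▸ ⟨_, sA⟩) (hB ▸ ⟨_, sB⟩) ?_ ?_
      · rw [hA]
        simp [n₁, hp0]
      · rw [hB]
        simp [n₁, n₃, hp0]
    · have hD : u - 6 * p - 9 * p = v := by rw [hv]; ring
      have hA : (y / (u - 6 * p - 9 * p)) ^ 2 + 27 * p - (u - 6 * p) - 9 * p = 15 * p * w / v := by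
        rw [hD, div_pow, heq]
        field_simp
        rw [hv, hw]
        ring
      have hB : (y / (u - 6 * p - 9 * p)) ^ 2 + 12 * p - (u - 6 * p) - 9 * p = -135 * p ^ 2 / v := by
        rw [hD, div_pow, heq]
        field_simp
        rw [hv, hw]
        ring
      have sA : 15 * p * w / v = r₁ * y / (u * v) * (r₁ * y / (u * v)) := by
        rw [show r₁ * y / (u * v) * (r₁ * y / (u * v)) = r₁ * r₁ * y ^ 2 / (u ^ 2 * v ^ 2) by ring, ← h₁, heq]
        field_simp
      have sB : -135 * p ^ 2 / v = 3 * p * r₂ / v * (3 * p * r₂ / v) := by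
        rw [show 3 * p * r₂ / v * (3 * p * r₂ / v) = 9 * p ^ 2 * (r₂ * r₂) / v ^ 2 by ring, ← h₂]
        field_simp
        norm_num
      refine key (nonsingular_root₂ hp.ne_zero) (by rw [← sub_ne_zero, hD]; exact n₂)
        (hA ▸ ⟨_, sA⟩) (hB ▸ ⟨_, sB⟩) ?_ ?_
      · rw [hA]
        simp [n₂, n₃, hp0]
      · rw [hB]
        simp [n₂, hp0]
    · have hD : u - 6 * p - 18 * p = w := by rw [hw]; ring
      have hA : (y / (u - 6 * p - 18 * p)) ^ 2 + 27 * p - (u - 6 * p) - 18 * p = 24 * p * v / w := by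
        rw [hD, div_pow, heq]
        field_simp
        rw [hv, hw]
        ring
      have hB : (y / (u - 6 * p - 18 * p)) ^ 2 + 12 * p - (u - 6 * p) - 18 * p = 9 * p * u / w := by
        rw [hD, div_pow, heq]
        field_simp
        rw [hv, hw]
        ring
      have sA : 24 * p * v / w = 2 * r₁ * y / (u * w) * (2 * r₁ * y / (u * w)) := by
        rw [show 2 * r₁ * y / (u * w) * (2 * r₁ * y / (u * w)) = 4 * (r₁ * r₁) * y ^ 2 / (u ^ 2 * w ^ 2) by ring, ← h₁, heq]
        field_simp
        norm_num
      have sB : 9 * p * u / w = 3 * r₂ * y / (v * w) * (3 * r₂ * y / (v * w)) := by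
        rw [show 3 * r₂ * y / (v * w) * (3 * r₂ * y / (v * w)) = 9 * (r₂ * r₂) * y ^ 2 / (v ^ 2 * w ^ 2) by ring, ← h₂, heq]
        field_simp
      refine key (nonsingular_root₃ hp.ne_zero) (by rw [← sub_ne_zero, hD]; exact n₃)
        (hA ▸ ⟨_, sA⟩) (hB ▸ ⟨_, sB⟩) ?_ ?_
      · rw [hA]
        simp [n₂, n₃, hp0]
      · rw [hB]
        simp [n₁, n₃, hp0]

end Descent

/-! ### The naive height and its growth under duplication. -/

open Height

section Height

/-- The logarithmic naive height of a rational point. -/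
noncomputable def naiveHeight (p : ℕ) (P : (curve p).toAffine.Point) : ℝ :=
  logHeight P.xRep

theorem naiveHeight_some {p : ℕ} {x y : ℚ} (h : (curve p).toAffine.Nonsingular x y) :
    naiveHeight p (.some x y h) = logHeight ![x, 1] := by
  rw [naiveHeight, Point.xRep_some]

instance northcott_naiveHeight (p : ℕ) : Northcott (naiveHeight p) where
  finite_le b := by
    have hfin : {x : ℚ | logHeight₁ x ≤ b}.Finite := Northcott.finite_le b
    have hT : (insert ![(1 : ℚ), 0] ((fun x : ℚ => ![x, 1]) '' {x : ℚ | logHeight₁ x ≤ b})).Finite :=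
      (hfin.image _).insert _
    refine Set.Finite.of_finite_fibers (Point.xRep (W' := (curve p).toAffine))
      (hT.subset ?_) ?_
    · rintro _ ⟨P, hP, rfl⟩
      match P, hP with
      | 0, _ => exact .inl (by rw [Point.xRep_zero])
      | .some x y h, hP =>
        refine .inr ⟨x, ?_, by rw [Point.xRep_some]⟩
        rw [Set.mem_ofPred_eq, naiveHeight_some] at hP
        rwa [Set.mem_ofPred_eq, logHeight₁_eq_logHeight]
    · rintro _ ⟨P, -, rfl⟩
      refine (Set.toFinite {P, -P}).subset ?_
      rintro Q ⟨-, hQ⟩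
      exact Point.eq_or_eq_neg_of_xRep_eq_xRep hQ

open MvPolynomial

/-- The numerator and denominator of the duplication map on `x`-coordinates. -/
noncomputable def duplication (s : ℚ) : Fin 2 → MvPolynomial (Fin 2) ℚ :=
  ![X 0 ^ 4 - C (288 * s ^ 3) * X 0 * X 1 ^ 3 + C (1008 * s ^ 4) * X 1 ^ 4,
    C 4 * X 0 ^ 3 * X 1 - C (28 * s) * X 0 ^ 2 * X 1 ^ 2 + C (144 * s ^ 3) * X 1 ^ 4]

/-- The binary cubic form with given coefficients. -/
noncomputable def cubicForm (a b c d : ℚ) : MvPolynomial (Fin 2) ℚ :=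
  C a * X 0 ^ 3 + C b * (X 0 ^ 2 * X 1) + C c * (X 0 * X 1 ^ 2) + C d * X 1 ^ 3

theorem cubicForm_isHomogeneous (a b c d : ℚ) : (cubicForm a b c d).IsHomogeneous 3 := by
  have h0 : (X 0 : MvPolynomial (Fin 2) ℚ).IsHomogeneous 1 := isHomogeneous_X _ _
  have h1 : (X 1 : MvPolynomial (Fin 2) ℚ).IsHomogeneous 1 := isHomogeneous_X _ _
  exact ((((h0.pow 3).C_mul a).add (((h0.pow 2).mul h1).C_mul b)).add
    ((h0.mul (h1.pow 2)).C_mul c)).add ((h1.pow 3).C_mul d)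

theorem exists_logHeight_duplication_ge {s : ℚ} (hs : s ≠ 0) :
    ∃ C, ∀ x : Fin 2 → ℚ,
      C + 4 * logHeight x ≤ logHeight (fun j => (duplication s j).eval x) := by
  -- Bézout cofactors: row k combines the two quartic duplication forms into the seventh power of
  -- the k-th variable. This witnesses their coprimality and gives the lower height bound.
  let q : Fin 2 × Fin 2 → MvPolynomial (Fin 2) ℚ :=
    ![![cubicForm 1 (63 / 5 * s) (-441 / 25 * s ^ 2) (-1944 / 25 * s ^ 3),
        cubicForm (-63 / 20 * s) (-441 / 25 * s ^ 2) (-801 / 25 * s ^ 3) (13608 / 25 * s ^ 4)],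
      ![cubicForm 0 (-1 / 4800 / s ^ 6) (7 / 7200 / s ^ 5) (49 / 14400 / s ^ 4),
        cubicForm (1 / 19200 / s ^ 6) (7 / 57600 / s ^ 5) 0 (-27 / 1600 / s ^ 3)]].uncurry
  have hq : ∀ a, (q a).IsHomogeneous 3 := by
    rintro ⟨i, j⟩
    fin_cases i <;> fin_cases j <;> exact cubicForm_isHomogeneous _ _ _ _
  obtain ⟨C, hC⟩ := logHeight_eval_ge' (M := 3) (N := 4) hq
  refine ⟨C, fun x => ?_⟩
  refine le_trans (by norm_num) (hC (duplication s) (x := x) fun k => ?_)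
  fin_cases k
  · simp [q, duplication, cubicForm, Fin.sum_univ_two]
    ring
  · simp [q, duplication, cubicForm, Fin.sum_univ_two]
    field_simp
    ring

theorem exists_naiveHeight_two_nsmul_ge {p : ℕ} (hp : p ≠ 0) :
    ∃ C, ∀ P : (curve p).toAffine.Point,
      4 * naiveHeight p P - C ≤ naiveHeight p ((2 : ℕ) • P) := by
  have hp0 : (p : ℚ) ≠ 0 := by exact_mod_cast hp
  -- With s = 3p the roots -6p, 9p, 18p are -2s, 3s, 6s.
  obtain ⟨C, hC⟩ := exists_logHeight_duplication_ge (s := 3 * p) (by simp [hp0])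
  have hzero : naiveHeight p 0 = 0 := by
    rw [naiveHeight, Point.xRep_zero, ← logHeight_swap, ← logHeight₁_eq_logHeight]
    simp
  refine ⟨max (-C) 0, fun P => ?_⟩
  match P with
  | 0 =>
    rw [show (2 : ℕ) • (0 : (curve p).toAffine.Point) = 0 by simp, hzero]
    simp
  | .some x y h =>
    have heq := equation_of_nonsingular h
    have hx := hC ![x, 1]
    have hG : (duplication (3 * p) 1).eval ![x, 1] = (2 * y) ^ 2 := by
      rw [mul_pow, heq]
      simp [duplication]
      ring
    have hF : (duplication (3 * p) 0).eval ![x, 1] =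
        x ^ 4 - 288 * (3 * p) ^ 3 * x + 1008 * (3 * p) ^ 4 := by
      simp [duplication]
    rw [naiveHeight_some]
    suffices hS : logHeight (fun j => (duplication (3 * p) j).eval ![x, 1]) =
        naiveHeight p ((2 : ℕ) • .some x y h) by
      rw [← hS]
      have := le_max_left (-C) 0
      linarith
    -- When y = 0 the second form vanishes and the first does not, so the value represents the point
    -- at infinity. Otherwise the forms are (2y)² times the coordinates of 2P.
    by_cases hy : y = 0
    · rw [(two_nsmul_some_eq_zero_iff h).2 hy, naiveHeight, Point.xRep_zero]
      have hF0 : (duplication (3 * p) 0).eval ![x, 1] ≠ 0 := by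
        rw [hF]
        rw [hy] at heq
        have h3 : (x + 6 * (p : ℚ)) * (x - 9 * (p : ℚ)) * (x - 18 * (p : ℚ)) = 0 := by
          rw [← heq]; ring
        rcases mul_eq_zero.1 h3 with h3 | h3
        · rcases mul_eq_zero.1 h3 with h3 | h3
          · obtain rfl : x = -6 * p := by linarith
            ring_nf
            positivity
          · obtain rfl : x = 9 * p := by linarith
            ring_nf
            positivity
        · obtain rfl : x = 18 * p := by linarith
          ring_nf
          positivity
      rw [← logHeight_smul_eq_logHeight ![(1 : ℚ), 0] hF0]
      congr 1
      ext j
      fin_cases j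
      · simp
      · simpa [hy] using hG
    · obtain ⟨y', h', h2⟩ := two_nsmul_some h hy
      rw [h2, naiveHeight_some, ← logHeight_smul_eq_logHeight ![_, (1 : ℚ)] (pow_ne_zero 2
        (mul_ne_zero two_ne_zero hy) : (2 * y) ^ 2 ≠ 0)]
      congr 1
      ext j
      fin_cases j
      · simp only [Fin.zero_eta, hF]
        simp
        field_simp
        rw [heq]
        ring
      · simpa using hG

end Height

/-- Every rational point is torsion. -/
theorem exists_smul_eq_zero {p : ℕ} (hp : p.Prime) (hmod : p % 120 = 53 ∨ p % 120 = 77)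
    (P : (curve p).toAffine.Point) : ∃ n : ℤ, n ≠ 0 ∧ n • P = 0 := by
  obtain ⟨C, hC⟩ := exists_naiveHeight_two_nsmul_ge hp.ne_zero
  -- The descent runs on 2E(ℚ), not on E(ℚ): only there is each element twice another element of the
  -- same set.
  obtain ⟨n, hn, h⟩ := exists_smul_eq_zero_of_halving (h := naiveHeight p) hC
    (D := Set.range fun Q : (curve p).toAffine.Point => (2 : ℕ) • Q) (P := (2 : ℕ) • P)
    (by
      rintro _ ⟨R, rfl⟩
      obtain ⟨Q, hQ⟩ := exists_two_nsmul_eq hp hmod R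
      exact ⟨_, ⟨Q, rfl⟩, hQ⟩) ⟨P, rfl⟩
  refine ⟨n * 2, mul_ne_zero hn two_ne_zero, ?_⟩
  rw [mul_smul, ← h]
  congr 1

end SelmerEp

theorem corollary1p2 (p : ℕ) (hp : p.Prime) (hmod : p % 120 = 53 ∨ p % 120 = 77) :
    SelmerEp.HasSelmerRank p 0 ∧
      Nat.card (SelmerEp.selmerTwo p) = 4 ∧
      Nat.card {P : (SelmerEp.curve p).toAffine.Point // (2 : ℕ) • P = 0} = 4 ∧
      Module.rank ℤ (SelmerEp.curve p).toAffine.Point = 0 := by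
  have hcard : Nat.card (SelmerEp.selmerTwo p) = 4 := by
    rw [SelmerEp.selmerTwo_eq hp hmod, SelmerEp.card_torsionClasses hp hmod]
  exact ⟨hcard, hcard, SelmerEp.card_two_torsion hp.ne_zero,
    rank_eq_zero_iff.2 (SelmerEp.exists_smul_eq_zero hp hmod)⟩
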